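/- For complex numbers $s_j=\sigma_j+it_j$ ($j=1,2,3$; $\sigma_j,t_j\in\mathbb{R}$), let $$\zeta_{AV,2}(s_1,s_2,s_3)=\sum_{m=1}^\infty\sum_{1\le n<m}\frac{1}{m^{s_1}n^{s_2}(m+n)^{s_3}}\qquad(\sigma_1,\sigma_2,\sigma_3>1)$$ be the Apostol-Vu double zeta-function, extended by analytic continuation; in the region $\sigma_1+\sigma_3>0$, $\sigma_1+\sigma_2+\sigma_3>2$ it is holomorphic except on the hyperplane $s_1+s_3=1$. For real $x$ let $$\zeta_{AV,2}^{[2]}(s_1,s_2,x)=\sum_{k=2}^\infty\Bigl|\sum_{k/2<m\le k-1}\frac{1}{m^{s_1}(k-m)^{s_2}}\Bigr|^2\frac{1}{k^{x}}.$$ Theorem. Let $s_1,s_2\in\mathbb{C}$ and $\sigma_3\in\mathbb{R}$ be fixed with $\sigma_1\ge 0$, $\sigma_3>0$, $\frac12<\sigma_1+\sigma_3\le 1$, $\sigma_1+\sigma_2+\sigma_3>2$ and $t_1\ge 0$. Then the series $\zeta_{AV,2}^{[2]}(s_1,s_2,2\sigma_3)$ converges, and for every $T\ge 2$ such that the point $(s_1,s_2,\sigma_3+it_3)$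 does not meet the hyperplane $s_1+s_3=1$ as $t_3$ moves from $2$ to $T$, the integral below exists and $$\int_2^T|\zeta_{AV,2}(s_1,s_2,\sigma_3+it_3)|^2\,dt_3=\zeta_{AV,2}^{[2]}(s_1,s_2,2\sigma_3)\,T+\begin{cases}O\bigl(T^{2-2\sigma_1-2\sigma_3}\log T\bigr)&(\tfrac12<\sigma_1+\sigma_3\le\tfrac34),\\ O\bigl(T^{1/2}\bigr)&(\tfrac34<\sigma_1+\sigma_3\le1),\end{cases}$$ where the implied constants depend only on $s_1$, $s_2$ and $\sigma_3$. -/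

import Mathlib

/-- The Apostol-Vu double series `∑_{m ≥ 1} ∑_{n < m} 1 / (m^{s₁} n^{s₂} (m+n)^{s₃})`
(`m` and `n` run over positive integers; the inner sum is empty for `m = 0` and `m = 1`). -/
noncomputable def apostolVuSeries (s₁ s₂ s₃ : ℂ) : ℂ :=
  ∑' m : ℕ, ∑ n ∈ Finset.Ico 1 m,
    1 / ((m : ℂ) ^ s₁ * (n : ℂ) ^ s₂ * ((m + n : ℕ) : ℂ) ^ s₃)

/-- The connected open set of all `(s₁, s₂, s₃)` with `Re (s₁ + s₃) > 0`,
`Re (s₁ + s₂ + s₃) > 2` that do not lie on the singular hyperplane `s₁ + s₃ = 1`. The other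
singular hyperplanes `s₁ + s₃ = 1 - l` (`l ≥ 1`) and `s₁ + s₂ + s₃ = 2 - l` (`l ≥ 0`) do not
meet the two half-spaces. -/
def apostolVuDomain : Set (ℂ × ℂ × ℂ) :=
  {p | 0 < (p.1 + p.2.2).re ∧ 2 < (p.1 + p.2.1 + p.2.2).re ∧ p.1 + p.2.2 ≠ 1}

/-- `F` is an analytic continuation of the Apostol-Vu double series, from the region
`Re s₁ > 1`, `Re s₂ > 1`, `Re s₃ > 1`, to `apostolVuDomain`: it is holomorphic there as a function
of three complex variables, and equals the series where the real parts exceed `1`. -/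
structure IsApostolVuContinuation (F : ℂ × ℂ × ℂ → ℂ) : Prop where
  differentiableOn : DifferentiableOn ℂ F apostolVuDomain
  eq_series : ∀ s₁ s₂ s₃ : ℂ, 1 < s₁.re → 1 < s₂.re → 1 < s₃.re →
    F (s₁, s₂, s₃) = apostolVuSeries s₁ s₂ s₃

theorem eq_zero_of_convex_of_open {f : ℂ → ℂ} {A B : Set ℂ} (hA : IsOpen A) (hc : Convex ℝ A)
    (hf : DifferentiableOn ℂ f A) (hB : IsOpen B) {z₀ : ℂ} (hzA : z₀ ∈ A) (hzB : z₀ ∈ B)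
    (h0 : ∀ z ∈ B, f z = 0) : ∀ z ∈ A, f z = 0 := by
  intro z hz
  exact (hf.analyticOnNhd hA).eqOn_zero_of_preconnected_of_eventuallyEq_zero hc.isPreconnected hzA
    (Filter.eventually_of_mem (hB.mem_nhds hzB) h0) hz

/-- The analytic continuation is unique. -/
theorem IsApostolVuContinuation.eqOn {F G : ℂ × ℂ × ℂ → ℂ}
    (hF : IsApostolVuContinuation F) (hG : IsApostolVuContinuation G) :
    Set.EqOn F G apostolVuDomain := by
  rintro ⟨s₁, s₂, s₃⟩ ⟨h1, h2, h3⟩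
  simp only [Complex.add_re] at h1 h2 h3
  -- Restrict to the complex line through the point in the direction `(1, 1, 1)`.
  set c : ℂ := (1 - (s₁ + s₃)) / 2 with hc
  have hc0 : c ≠ 0 := by
    intro h
    apply h3
    have : 1 - (s₁ + s₃) = 0 := by simpa [hc] using h
    linear_combination -this
  obtain ⟨d, hd, hd1, hd2⟩ : ∃ d : ℝ, 0 < d ∧ 2 * d ≤ s₁.re + s₃.re ∧
      3 * d ≤ s₁.re + s₂.re + s₃.re - 2 :=
    ⟨min ((s₁.re + s₃.re) / 2) ((s₁.re + s₂.re + s₃.re - 2) / 3),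
      lt_min (by linarith) (by linarith),
      by linarith [min_le_left ((s₁.re + s₃.re) / 2) ((s₁.re + s₂.re + s₃.re - 2) / 3)],
      by linarith [min_le_right ((s₁.re + s₃.re) / 2) ((s₁.re + s₂.re + s₃.re - 2) / 3)]⟩
  let L : ℂ → ℂ × ℂ × ℂ := fun z => (s₁ + z, s₂ + z, s₃ + z)
  let f : ℂ → ℂ := fun z => F (L z) - G (L z)
  have hL : ∀ z : ℂ, -d < z.re → z ≠ c → L z ∈ apostolVuDomain := by
    intro z hz hzc
    refine ⟨?_, ?_, ?_⟩
    · simp only [L, Complex.add_re]; linarith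
    · simp only [L, Complex.add_re]; linarith
    · intro h
      apply hzc
      simp only [L] at h
      rw [hc]
      linear_combination h / 2
  have hf : DifferentiableOn ℂ f {z | -d < z.re ∧ z ≠ c} := by
    have hLd : DifferentiableOn ℂ L {z | -d < z.re ∧ z ≠ c} := by
      simp only [L]; fun_prop
    exact (hF.differentiableOn.comp hLd fun z hz => hL z hz.1 hz.2).sub
      (hG.differentiableOn.comp hLd fun z hz => hL z hz.1 hz.2)
  have key : ∀ A : Set ℂ, IsOpen A → Convex ℝ A → A ⊆ {z | -d < z.re ∧ z ≠ c} →
      ∀ B : Set ℂ, IsOpen B → ∀ z₀, z₀ ∈ A → z₀ ∈ B → (∀ z ∈ B, f z = 0) →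
      ∀ z ∈ A, f z = 0 := fun A hA hAc hAs B hB z₀ hzA hzB h0 =>
    eq_zero_of_convex_of_open hA hAc (hf.mono hAs) hB hzA hzB h0
  have o1 : ∀ r : ℝ, IsOpen {z : ℂ | r < z.re} := fun r =>
    isOpen_lt continuous_const Complex.continuous_re
  have o2 : ∀ r : ℝ, IsOpen {z : ℂ | z.re < r} := fun r =>
    isOpen_lt Complex.continuous_re continuous_const
  have o3 : ∀ r : ℝ, IsOpen {z : ℂ | r < z.im} := fun r =>
    isOpen_lt continuous_const Complex.continuous_im
  have o4 : ∀ r : ℝ, IsOpen {z : ℂ | z.im < r} := fun r =>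
    isOpen_lt Complex.continuous_im continuous_const
  have k1 := convex_halfSpace_re_gt
  have k2 := convex_halfSpace_re_lt
  have k3 := convex_halfSpace_im_gt
  have k4 := convex_halfSpace_im_lt
  obtain ⟨R, hR1, hR2, hR3, hRd, hRc⟩ : ∃ R : ℝ, 1 - s₁.re < R ∧ 1 - s₂.re < R ∧ 1 - s₃.re < R ∧
      0 < R ∧ c.re < R := by
    refine ⟨|s₁.re| + |s₂.re| + |s₃.re| + |c.re| + 2, ?_, ?_, ?_, ?_, ?_⟩ <;>
    linarith [neg_abs_le s₁.re, neg_abs_le s₂.re, neg_abs_le s₃.re, abs_nonneg s₁.re,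
      abs_nonneg s₂.re, abs_nonneg s₃.re, le_abs_self c.re, abs_nonneg c.re]
  have z0 : ∀ z ∈ {z : ℂ | R < z.re}, f z = 0 := by
    intro z hz
    have hz' : R < z.re := hz
    simp only [f, L]
    rw [hF.eq_series _ _ _ (by rw [Complex.add_re]; linarith) (by rw [Complex.add_re]; linarith)
      (by rw [Complex.add_re]; linarith), hG.eq_series _ _ _ (by rw [Complex.add_re]; linarith)
      (by rw [Complex.add_re]; linarith) (by rw [Complex.add_re]; linarith), sub_self]
  have z1 : ∀ z ∈ {z : ℂ | -d < z.re} ∩ {z | c.re < z.re}, f z = 0 := by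
    refine key _ ((o1 _).inter (o1 _)) ((k1 _).inter (k1 _)) ?_ _ (o1 R) ⟨R + 1, 0⟩ ?_ ?_ z0
    · rintro z ⟨hz, hz'⟩
      exact ⟨hz, fun h => by simp [h] at hz'⟩
    · constructor <;> simp only [Set.mem_ofPred_eq] <;> linarith
    · simp only [Set.mem_ofPred_eq]; linarith
  have z2 : ∀ z ∈ {z : ℂ | -d < z.re} ∩ {z | c.im < z.im}, f z = 0 := by
    refine key _ ((o1 _).inter (o3 _)) ((k1 _).inter (k3 _)) ?_ _ ((o1 _).inter (o1 _))
      ⟨R + 1, c.im + 1⟩ ?_ ?_ z1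
    · rintro z ⟨hz, hz'⟩
      exact ⟨hz, fun h => by simp [h] at hz'⟩
    · constructor <;> simp only [Set.mem_ofPred_eq] <;> linarith
    · constructor <;> simp only [Set.mem_ofPred_eq] <;> linarith
  have z4 : ∀ z ∈ {z : ℂ | -d < z.re} ∩ {z | z.im < c.im}, f z = 0 := by
    refine key _ ((o1 _).inter (o4 _)) ((k1 _).inter (k4 _)) ?_ _ ((o1 _).inter (o1 _))
      ⟨R + 1, c.im - 1⟩ ?_ ?_ z1
    · rintro z ⟨hz, hz'⟩
      exact ⟨hz, fun h => by simp [h] at hz'⟩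
    · constructor <;> simp only [Set.mem_ofPred_eq] <;> linarith
    · constructor <;> simp only [Set.mem_ofPred_eq] <;> linarith
  have hfin : f 0 = 0 := by
    rcases lt_trichotomy c.re 0 with h | h | h
    · exact z1 0 ⟨by simpa using hd, by simpa using h⟩
    · have him : c.im ≠ 0 := fun h' => hc0 (Complex.ext h h')
      rcases lt_or_gt_of_ne him with h' | h'
      · exact z2 0 ⟨by simpa using hd, by simpa using h'⟩
      · exact z4 0 ⟨by simpa using hd, by simpa using h'⟩
    · refine key ({z : ℂ | -d < z.re} ∩ {z | z.re < c.re}) ((o1 _).inter (o2 _))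
        ((k1 _).inter (k2 _)) ?_ _ ((o1 _).inter (o3 _)) ⟨0, c.im + 1⟩ ?_ ?_ z2 0
        ⟨by simpa using hd, by simpa using h⟩
      · rintro z ⟨hz, hz'⟩
        exact ⟨hz, fun h => by simp [h] at hz'⟩
      · constructor <;> simp only [Set.mem_ofPred_eq] <;> linarith
      · constructor <;> simp only [Set.mem_ofPred_eq] <;> linarith
  simpa [f, L, sub_eq_zero] using hfin

open Classical in
/-- The Apostol-Vu double zeta-function `ζ_{AV,2}(s₁, s₂, s₃)` on `apostolVuDomain`: the value of
the analytic continuation of the Apostol-Vu double series (the values outside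
`apostolVuDomain` carry no meaning). -/
noncomputable def apostolVuZeta (s₁ s₂ s₃ : ℂ) : ℂ :=
  if h : ∃ F, IsApostolVuContinuation F then h.choose (s₁, s₂, s₃) else 0

/-- The `k`-th term `|∑_{k/2 < m ≤ k-1} 1 / (m^{s₁} (k-m)^{s₂})|² / k^{x}` of the series
`ζ^{[2]}_{AV,2}(s₁, s₂, x)`, for real `x`. It is `0` for `k = 0` and `k = 1`. -/
noncomputable def apostolVuSqTerm (s₁ s₂ : ℂ) (x : ℝ) (k : ℕ) : ℝ :=
  ‖∑ m ∈ (Finset.range k).filter (fun m => k < 2 * m),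
      1 / ((m : ℂ) ^ s₁ * ((k - m : ℕ) : ℂ) ^ s₂)‖ ^ 2 / (k : ℝ) ^ x

/-- `ζ^{[2]}_{AV,2}(s₁, s₂, x) = ∑_{k ≥ 2} |∑_{k/2 < m ≤ k-1} 1 / (m^{s₁} (k-m)^{s₂})|² / k^{x}`
for real `x`. -/
noncomputable def apostolVuSq (s₁ s₂ : ℂ) (x : ℝ) : ℝ :=
  ∑' k : ℕ, apostolVuSqTerm s₁ s₂ x k

/-! Write σ = σ₁ + σ₃ and t = Im s₃. For each n, the sum over m > n of m^(-s₁) (m+n)^(-s₃) is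
compared with a telescoping sum of increments of an explicit approximate primitive. The difference
per term, `kernelDefect`, is O(m^(-σ-1)), so "primitive at the start plus sum of defects"
(`kernelTail`) makes sense for σ > 0 off s₁ + s₃ = 1, and equals the genuine sum for σ > 1.
Weighting by n^(-s₂) and summing over n converges when σ₁ + σ₂ + σ₃ > 2. This gives an explicit
continuation (`isApostolVuContinuation_apostolVuContinuation`), and uniqueness identifies it with
`apostolVuZeta`.

The trivial defect bound carries a factor |s₃| and is too weak for large t. Once the starting point
M exceeds 2(|s₁| + |s₃|), the kernel varies like k(x) exp(ωu) on [x, x+1], where ω is its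
logarithmic derivative and |ω| ≤ 1/2. To leading order the defect is then itself an increment, so it
telescopes as well, and the tail is O(M^(1-σ)/t) (`exists_norm_kernelTail_le`). Since t₁ ≥ 0, both ω
≠ 0 and |s₁ + s₃ - 1| ≥ t hold.

Grouping the terms by k = m + n, the zeta-function on [T, 2T] is therefore a Dirichlet polynomial of
length K ≍ T with coefficients O(k^(-σ₁)), up to a pointwise error O(T^(-σ))
(`exists_norm_apostolVuContinuation_sub_le`). In the mean square of the polynomial the diagonal
gives the main term, and the off-diagonal terms are estimated by 1/|log(j/i)|
(`exists_apostolVuPartial_meanSquare`). With any τ ≤ σ in (1/2, 1), the off-diagonal terms, the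
missing diagonal tail and the approximation error are all O(T^(2-2τ) log T). Dyadic summation keeps
this bound. Taking τ = σ for σ ≤ 3/4, and some τ > 3/4 otherwise, gives the two cases. -/

/-! ### The kernel `x ^ (-s₁) * (x + a) ^ (-s₃)` and its approximate primitive -/

/-- The function `x ↦ x ^ (-s₁) * (x + a) ^ (-s₃)`. -/
noncomputable def kernel (s₁ s₃ : ℂ) (a x : ℝ) : ℂ :=
  (x : ℂ) ^ (-s₁) * ((x + a : ℝ) : ℂ) ^ (-s₃)

/-- The logarithmic derivative of `kernel s₁ s₃ a`. -/
noncomputable def kernelLogDeriv (s₁ s₃ : ℂ) (a x : ℝ) : ℂ :=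
  -s₁ / (x : ℂ) + -s₃ / ((x + a : ℝ) : ℂ)

/-- The negative of an approximate primitive of `kernel s₁ s₃ a`, vanishing at infinity for
`Re (s₁ + s₃) > 1`. -/
noncomputable def kernelPrimitive (s₁ s₃ : ℂ) (a x : ℝ) : ℂ :=
  (x : ℂ) ^ (-s₁) * ((x + a : ℝ) : ℂ) ^ (1 - s₃) / (s₁ + s₃ - 1)

/-- The difference between the kernel and the corresponding increment of its primitive. -/
noncomputable def kernelDefect (s₁ s₃ : ℂ) (a x : ℝ) : ℂ :=
  kernel s₁ s₃ a x + kernelPrimitive s₁ s₃ a (x + 1) - kernelPrimitive s₁ s₃ a x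

theorem hasDerivAt_ofReal_add_cpow (c : ℂ) {a x : ℝ} (h : 0 < x + a) :
    HasDerivAt (fun y : ℝ => ((y + a : ℝ) : ℂ) ^ c)
      (((x + a : ℝ) : ℂ) ^ c * (c / ((x + a : ℝ) : ℂ))) x := by
  have h1 : HasDerivAt (fun y : ℝ => ((y + a : ℝ) : ℂ)) ((1 : ℝ) : ℂ) x :=
    ((hasDerivAt_id x).add_const a).ofReal_comp
  have h2 : HasDerivAt (fun y : ℝ => ((y + a : ℝ) : ℂ) ^ c)
      (((1 : ℝ) : ℂ) • (c * ((x + a : ℝ) : ℂ) ^ (c - 1))) x :=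
    HasDerivAt.scomp x (g₁ := fun z : ℂ => z ^ c) (h := fun y : ℝ => ((y + a : ℝ) : ℂ))
      (Complex.hasStrictDerivAt_cpow_const (Complex.ofReal_mem_slitPlane.2 h)).hasDerivAt h1
  convert h2 using 1
  have h0 : ((x + a : ℝ) : ℂ) ≠ 0 := by exact_mod_cast h.ne'
  rw [Complex.cpow_sub _ _ h0, Complex.cpow_one]
  simp only [Complex.ofReal_one, one_smul]
  field_simp

theorem hasDerivAt_kernel (s₁ s₃ : ℂ) {a x : ℝ} (hx : 0 < x) (ha : 0 ≤ a) :
    HasDerivAt (kernel s₁ s₃ a) (kernel s₁ s₃ a x * kernelLogDeriv s₁ s₃ a x) x := by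
  have h1 := hasDerivAt_ofReal_add_cpow (-s₁) (a := 0) (x := x) (by linarith)
  have h2 := hasDerivAt_ofReal_add_cpow (-s₃) (a := a) (x := x) (by linarith)
  simp only [add_zero] at h1
  refine (h1.mul h2).congr_deriv ?_
  simp only [kernel, kernelLogDeriv]
  ring

/-- The numerator of the logarithmic derivative, -s₁(x+a)/x + 1 - s₃, equals -(s₁+s₃-1) - s₁a/x. The
primitive is thus exact up to a relative error of order a/x. -/
theorem hasDerivAt_kernelPrimitive {s₁ s₃ : ℂ} (hs : s₁ + s₃ ≠ 1) {a x : ℝ} (hx : 0 < x)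
    (ha : 0 ≤ a) :
    HasDerivAt (kernelPrimitive s₁ s₃ a)
      (-kernel s₁ s₃ a x - s₁ * a / ((s₁ + s₃ - 1) * x) * kernel s₁ s₃ a x) x := by
  have h1 := hasDerivAt_ofReal_add_cpow (-s₁) (a := 0) (x := x) (by linarith)
  have h2 := hasDerivAt_ofReal_add_cpow (1 - s₃) (a := a) (x := x) (by linarith)
  simp only [add_zero] at h1
  refine ((h1.mul h2).div_const (s₁ + s₃ - 1)).congr_deriv ?_
  have h0 : ((x + a : ℝ) : ℂ) ≠ 0 := by exact_mod_cast (by linarith : (0 : ℝ) < x + a).ne'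
  have h0' : (x : ℂ) ≠ 0 := by exact_mod_cast hx.ne'
  have hs' : s₁ + s₃ - 1 ≠ 0 := sub_ne_zero.2 hs
  have h3 : ((x + a : ℝ) : ℂ) ^ (1 - s₃) = ((x + a : ℝ) : ℂ) * ((x + a : ℝ) : ℂ) ^ (-s₃) := by
    rw [sub_eq_add_neg, Complex.cpow_add _ _ h0, Complex.cpow_one]
  simp only [kernel]
  rw [h3]
  push_cast at h0 ⊢
  field_simp
  ring

/-! ### Size estimates for the kernel, its primitive and the defect. -/

theorem rpow_le_two_rpow_abs_mul {x y : ℝ} (hx : 0 < x) (hxy : x ≤ y) (hy : y ≤ 2 * x) (c : ℝ) :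
    y ^ c ≤ 2 ^ |c| * x ^ c := by
  rcases le_total 0 c with hc | hc
  · rw [abs_of_nonneg hc, ← Real.mul_rpow (by norm_num) hx.le]
    exact Real.rpow_le_rpow (by linarith) hy hc
  · calc y ^ c ≤ x ^ c := Real.rpow_le_rpow_of_nonpos hx hxy hc
      _ ≤ 2 ^ |c| * x ^ c := le_mul_of_one_le_left (by positivity)
          (Real.one_le_rpow (by norm_num) (abs_nonneg c))

theorem norm_kernel_le (s₁ s₃ : ℂ) {a x : ℝ} (hx : 0 < x) (ha : 0 ≤ a) (hax : a ≤ x) :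
    ‖kernel s₁ s₃ a x‖ ≤ 2 ^ |s₃.re| * x ^ (-(s₁.re + s₃.re)) := by
  rw [kernel, norm_mul, Complex.norm_cpow_eq_rpow_re_of_pos hx,
    Complex.norm_cpow_eq_rpow_re_of_pos (by linarith), neg_add, Real.rpow_add hx, Complex.neg_re,
    Complex.neg_re]
  have h := rpow_le_two_rpow_abs_mul hx (by linarith : x ≤ x + a) (by linarith) (-s₃.re)
  rw [abs_neg] at h
  calc _ ≤ x ^ (-s₁.re) * (2 ^ |s₃.re| * x ^ (-s₃.re)) :=
        mul_le_mul_of_nonneg_left h (by positivity)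
    _ = _ := by ring

theorem norm_kernelPrimitive_le (s₁ s₃ : ℂ) {a x : ℝ} (hx : 0 < x) (ha : 0 ≤ a) (hax : a ≤ x) :
    ‖kernelPrimitive s₁ s₃ a x‖ ≤
      2 ^ |1 - s₃.re| * x ^ (1 - (s₁.re + s₃.re)) / ‖s₁ + s₃ - 1‖ := by
  rw [kernelPrimitive, norm_div, norm_mul, Complex.norm_cpow_eq_rpow_re_of_pos hx,
    Complex.norm_cpow_eq_rpow_re_of_pos (by linarith),
    (by ring : 1 - (s₁.re + s₃.re) = -s₁.re + (1 - s₃.re)), Real.rpow_add hx]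
  have h := rpow_le_two_rpow_abs_mul hx (by linarith : x ≤ x + a) (by linarith) (1 - s₃.re)
  simp only [Complex.neg_re, Complex.sub_re, Complex.one_re]
  refine div_le_div_of_nonneg_right ?_ (norm_nonneg _)
  calc _ ≤ x ^ (-s₁.re) * (2 ^ |1 - s₃.re| * x ^ (1 - s₃.re)) :=
        mul_le_mul_of_nonneg_left h (by positivity)
    _ = _ := by ring

theorem norm_kernelLogDeriv_le (s₁ s₃ : ℂ) {a x : ℝ} (hx : 0 < x) (ha : 0 ≤ a) :
    ‖kernelLogDeriv s₁ s₃ a x‖ ≤ (‖s₁‖ + ‖s₃‖) / x := by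
  have h1 : ‖(x : ℂ)‖ = x := by simp [abs_of_pos hx]
  have h2 : ‖((x + a : ℝ) : ℂ)‖ = x + a := by
    rw [Complex.norm_real, Real.norm_of_nonneg (by linarith)]
  calc _ ≤ ‖-s₁ / (x : ℂ)‖ + ‖-s₃ / ((x + a : ℝ) : ℂ)‖ := norm_add_le _ _
    _ = ‖s₁‖ / x + ‖s₃‖ / (x + a) := by rw [norm_div, norm_div, h1, h2, norm_neg, norm_neg]
    _ ≤ ‖s₁‖ / x + ‖s₃‖ / x := by gcongr; linarith
    _ = _ := by ring

theorem norm_kernelLogDeriv_sub_le (s₁ s₃ : ℂ) {a x u : ℝ} (hx : 0 < x) (ha : 0 ≤ a)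
    (hu : 0 ≤ u) (hu1 : u ≤ 1) :
    ‖kernelLogDeriv s₁ s₃ a (x + u) - kernelLogDeriv s₁ s₃ a x‖ ≤ (‖s₁‖ + ‖s₃‖) / x ^ 2 := by
  have key : ∀ (s : ℂ) {y : ℝ}, x ≤ y →
      ‖-s / ((y + u : ℝ) : ℂ) - -s / (y : ℂ)‖ ≤ ‖s‖ / x ^ 2 := by
    intro s y hy
    have hy0 : 0 < y := by linarith
    have e : -s / ((y + u : ℝ) : ℂ) - -s / (y : ℂ) = s * ((u / (y * (y + u)) : ℝ) : ℂ) := by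
      have h1 : ((y : ℝ) : ℂ) ≠ 0 := by exact_mod_cast hy0.ne'
      have h2 : ((y + u : ℝ) : ℂ) ≠ 0 := by exact_mod_cast (by linarith : 0 < y + u).ne'
      push_cast at h2 ⊢
      field_simp
      ring
    rw [e, norm_mul, Complex.norm_real, Real.norm_of_nonneg (by positivity),
      div_eq_mul_one_div ‖s‖]
    refine mul_le_mul_of_nonneg_left ?_ (norm_nonneg _)
    exact div_le_div₀ zero_le_one hu1 (by positivity) (by nlinarith)
  have e : kernelLogDeriv s₁ s₃ a (x + u) - kernelLogDeriv s₁ s₃ a x =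
      (-s₁ / ((x + u : ℝ) : ℂ) - -s₁ / (x : ℂ)) +
      (-s₃ / ((x + a + u : ℝ) : ℂ) - -s₃ / ((x + a : ℝ) : ℂ)) := by
    rw [kernelLogDeriv, kernelLogDeriv, (by ring : x + u + a = x + a + u)]
    ring
  rw [e, add_div]
  exact (norm_add_le _ _).trans (add_le_add (key s₁ le_rfl) (key s₃ (by linarith)))

theorem norm_kernel_add_le {s₁ s₃ : ℂ} (hσ : 0 < s₁.re + s₃.re) {a x u : ℝ} (hx : 0 < x)
    (ha : 0 ≤ a) (hax : a ≤ x) (hu : 0 ≤ u) :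
    ‖kernel s₁ s₃ a (x + u)‖ ≤ 2 ^ |s₃.re| * x ^ (-(s₁.re + s₃.re)) := by
  refine (norm_kernel_le s₁ s₃ (by linarith) ha (by linarith)).trans ?_
  exact mul_le_mul_of_nonneg_left
    (Real.rpow_le_rpow_of_nonpos hx (by linarith) (by linarith)) (by positivity)

theorem norm_image_one_sub_le {f f' : ℝ → ℂ} {C : ℝ}
    (hf : ∀ u ∈ Set.Icc (0 : ℝ) 1, HasDerivAt f (f' u) u)
    (hC : ∀ u ∈ Set.Icc (0 : ℝ) 1, ‖f' u‖ ≤ C) : ∀ u ∈ Set.Icc (0 : ℝ) 1, ‖f u - f 0‖ ≤ C := by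
  intro u hu
  have h := norm_image_sub_le_of_norm_deriv_le_segment'
    (fun x hx => (hf x hx).hasDerivWithinAt) (fun x hx => hC x (Set.Ico_subset_Icc_self hx)) u hu
  have h0 : 0 ≤ C := (norm_nonneg _).trans (hC u hu)
  exact h.trans (by nlinarith [hu.1, hu.2])

theorem norm_mul_div_mul_kernel_le {s₁ s₃ : ℂ} (hσ : 0 < s₁.re + s₃.re) {a x u : ℝ}
    (hx : 0 < x) (ha : 0 ≤ a) (hax : a ≤ x) (hu : 0 ≤ u) :
    ‖s₁ * a / ((s₁ + s₃ - 1) * ((x + u : ℝ) : ℂ)) * kernel s₁ s₃ a (x + u)‖ ≤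
      ‖s₁‖ * a / ‖s₁ + s₃ - 1‖ / x * (2 ^ |s₃.re| * x ^ (-(s₁.re + s₃.re))) := by
  rw [norm_mul, norm_div, norm_mul, norm_mul, Complex.norm_real, Complex.norm_real,
    Real.norm_of_nonneg ha, Real.norm_of_nonneg (by linarith : 0 ≤ x + u), ← div_div]
  have := norm_kernel_add_le hσ hx ha hax hu
  gcongr
  linarith

/-- The trivial bound for the defect. -/
theorem norm_kernelDefect_le {s₁ s₃ : ℂ} (hσ : 0 < s₁.re + s₃.re) (hs : s₁ + s₃ ≠ 1) {a x : ℝ}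
    (hx : 0 < x) (ha : 0 ≤ a) (hax : a ≤ x) :
    ‖kernelDefect s₁ s₃ a x‖ ≤
      2 ^ |s₃.re| * (‖s₁‖ + ‖s₃‖ + ‖s₁‖ * a / ‖s₁ + s₃ - 1‖) * x ^ (-(s₁.re + s₃.re) - 1) := by
  set G : ℝ := 2 ^ |s₃.re| * x ^ (-(s₁.re + s₃.re)) with hG
  have hGd : ∀ u ∈ Set.Icc (0 : ℝ) 1,
      ‖kernel s₁ s₃ a (x + u) - kernel s₁ s₃ a (x + 0)‖ ≤ G * ((‖s₁‖ + ‖s₃‖) / x) := by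
    refine norm_image_one_sub_le (f := fun u => kernel s₁ s₃ a (x + u))
      (fun u hu => (hasDerivAt_kernel s₁ s₃ (by linarith [hu.1]) ha).comp_const_add x u)
      fun u hu => ?_
    rw [norm_mul]
    refine mul_le_mul (norm_kernel_add_le hσ hx ha hax hu.1)
      ((norm_kernelLogDeriv_le s₁ s₃ (by linarith [hu.1]) ha).trans ?_) (norm_nonneg _)
      (by positivity)
    gcongr
    linarith [hu.1]
  -- The defect is the increment over [0, 1] of u ↦ Q(x+u) + u·k(x), with k the kernel and Q its
  -- `kernelPrimitive`. The derivative is k(x) - k(x+u) minus the a/x error of the primitive.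
  have h := norm_image_one_sub_le
    (f := fun u => kernelPrimitive s₁ s₃ a (x + u) + u * kernel s₁ s₃ a x)
    (C := G * ((‖s₁‖ + ‖s₃‖) / x) + ‖s₁‖ * a / ‖s₁ + s₃ - 1‖ / x * G)
    (fun u hu => ((hasDerivAt_kernelPrimitive hs (by linarith [hu.1]) ha).comp_const_add x u).add
      ((hasDerivAt_id u).ofReal_comp.mul_const (kernel s₁ s₃ a x)))
    (fun u hu => by
      have h1 := hGd u hu
      rw [add_zero, norm_sub_rev] at h1
      have h2 := norm_mul_div_mul_kernel_le (s₁ := s₁) (s₃ := s₃) hσ hx ha hax hu.1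
      refine le_trans (le_of_eq ?_) ((norm_sub_le _ _).trans (add_le_add h1 h2))
      congr 1
      push_cast
      ring) 1 ⟨by norm_num, le_rfl⟩
  simp only [add_zero, Complex.ofReal_one, one_mul, Complex.ofReal_zero, zero_mul] at h
  calc ‖kernelDefect s₁ s₃ a x‖ = ‖kernelPrimitive s₁ s₃ a (x + 1) + kernel s₁ s₃ a x -
        kernelPrimitive s₁ s₃ a x‖ := by rw [kernelDefect]; congr 1; ring
    _ ≤ _ := h
    _ = _ := by
      rw [Real.rpow_sub_one hx.ne', hG]
      ring

/-- A holomorphic solution of `(exp z - 1) * c z = 1 - (exp z - 1) / z`, bounded and Lipschitz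
near the origin. -/
theorem exists_euler_maclaurin_multiplier : ∃ (c : ℂ → ℂ) (C : ℝ), 0 ≤ C ∧
    (∀ z, z ≠ 0 → ‖z‖ ≤ 1 / 2 → (Complex.exp z - 1) * c z = 1 - (Complex.exp z - 1) / z) ∧
    (∀ z, ‖z‖ ≤ 1 / 2 → ‖c z‖ ≤ C) ∧
    ∀ z w, ‖z‖ ≤ 1 / 2 → ‖w‖ ≤ 1 / 2 → ‖c z - c w‖ ≤ C * ‖z - w‖ := by
  -- E = (exp z - 1)/z and D = (E - 1)/z extend to entire functions, and the equation for the
  -- multiplier becomes zE·c = 1 - E = -zD, so c = -D/E.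
  set E : ℂ → ℂ := dslope Complex.exp 0 with hE
  have hEd : Differentiable ℂ E := by
    rw [← differentiableOn_univ, Complex.differentiableOn_dslope Filter.univ_mem]
    exact Complex.differentiable_exp.differentiableOn
  set D : ℂ → ℂ := dslope E 0 with hD
  have hDd : Differentiable ℂ D := by
    rw [← differentiableOn_univ, Complex.differentiableOn_dslope Filter.univ_mem]
    exact hEd.differentiableOn
  have hE1 : ∀ z, z ≠ 0 → E z = (Complex.exp z - 1) / z := by
    intro z hz
    rw [hE, dslope_of_ne _ hz, slope_def_field]
    simp
  have hE0 : E 0 = 1 := by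
    rw [hE, dslope_same]
    simp
  have hD1 : ∀ z, z ≠ 0 → D z = (E z - 1) / z := by
    intro z hz
    rw [hD, dslope_of_ne _ hz, slope_def_field]
    simp [hE0]
  -- If exp z = 1, then |z| = |exp z - 1 - z| ≤ |z|², which is impossible for 0 < |z| < 1.
  have hEne : ∀ z ∈ Metric.ball (0 : ℂ) 1, E z ≠ 0 := by
    intro z hz h
    rw [mem_ball_zero_iff] at hz
    by_cases hz0 : z = 0
    · rw [hz0, hE0] at h
      exact one_ne_zero h
    · rw [hE1 z hz0, div_eq_zero_iff] at h
      have h2 : Complex.exp z - 1 = 0 := h.resolve_right hz0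
      have h3 := Complex.norm_exp_sub_one_sub_id_le hz.le
      rw [h2, zero_sub, norm_neg] at h3
      nlinarith [norm_pos_iff.2 hz0]
  have hsub : Metric.closedBall (0 : ℂ) (1 / 2) ⊆ Metric.ball 0 1 :=
    Metric.closedBall_subset_ball (by norm_num)
  have hcd : DifferentiableOn ℂ (fun z => -D z / E z) (Metric.ball 0 1) :=
    (hDd.differentiableOn.neg).div hEd.differentiableOn hEne
  have hcc : ContinuousOn (deriv fun z => -D z / E z) (Metric.closedBall 0 (1 / 2)) :=
    ((hcd.deriv Metric.isOpen_ball).continuousOn).mono hsub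
  obtain ⟨C₁, hC₁⟩ := (isCompact_closedBall (0 : ℂ) (1 / 2)).exists_bound_of_continuousOn hcc
  obtain ⟨C₂, hC₂⟩ := (isCompact_closedBall (0 : ℂ) (1 / 2)).exists_bound_of_continuousOn
    (hcd.continuousOn.mono hsub)
  refine ⟨fun z => -D z / E z, max (max C₁ C₂) 0, le_max_right _ _, fun z hz hz2 => ?_,
    fun z hz => ?_, fun z w hz hw => ?_⟩
  · have h1 := hEne z (hsub (mem_closedBall_zero_iff.2 hz2))
    have h2 := hE1 z hz
    have h3 : Complex.exp z - 1 = z * E z := by rw [h2]; field_simp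
    simp only [hD1 z hz, h3]
    field_simp
    ring
  · exact (hC₂ z (mem_closedBall_zero_iff.2 hz)).trans
      ((le_max_right _ _).trans (le_max_left _ _))
  · refine (Convex.norm_image_sub_le_of_norm_deriv_le (𝕜 := ℂ) (s := Metric.closedBall (0 : ℂ) (1 / 2))
      (fun x hx => hcd.differentiableAt (Metric.isOpen_ball.mem_nhds (hsub hx))) hC₁
      (convex_closedBall _ _) (mem_closedBall_zero_iff.2 hw) (mem_closedBall_zero_iff.2 hz)).trans ?_
    gcongr
    exact (le_max_left _ _).trans (le_max_left _ _)

/-! ### Power sums and the regularized tail of the kernel. -/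

theorem rpow_neg_succ_le_sub {σ y : ℝ} (hσ : 0 < σ) (hy : 1 ≤ y) :
    σ * 2 ^ (-(σ + 1)) * y ^ (-σ - 1) ≤ y ^ (-σ) - (y + 1) ^ (-σ) := by
  obtain ⟨c, hc, h⟩ := exists_hasDerivAt_eq_slope (fun x : ℝ => x ^ (-σ))
    (fun x => -σ * x ^ (-σ - 1)) (by linarith : y < y + 1)
    (fun x hx => (Real.continuousAt_rpow_const x (-σ)
      (Or.inl (by linarith [hx.1]))).continuousWithinAt)
    (fun x hx => Real.hasDerivAt_rpow_const (Or.inl (by linarith [hx.1])))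
  have h1 : (2 * y) ^ (-σ - 1) ≤ c ^ (-σ - 1) :=
    Real.rpow_le_rpow_of_nonpos (by linarith [hc.1]) (by linarith [hc.2]) (by linarith)
  rw [Real.mul_rpow (by norm_num) (by linarith), (by ring : -σ - 1 = -(σ + 1))] at h1
  have h2 := mul_le_mul_of_nonneg_left h1 hσ.le
  rw [(by ring : -σ - 1 = -(σ + 1))] at h ⊢
  simp only [add_sub_cancel_left, div_one] at h
  linarith

/-- By the mean value theorem each term is at most a constant times an increment of y ↦ -y^(-σ), and
the increments telescope. The bound is uniform in `J`, so it also yields convergence. -/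
theorem sum_range_rpow_neg_succ_le {σ M : ℝ} (hσ : 0 < σ) (hM : 1 ≤ M) (J : ℕ) :
    ∑ j ∈ Finset.range J, (M + j) ^ (-σ - 1) ≤ 2 ^ (σ + 1) / σ * M ^ (-σ) := by
  have h : σ * 2 ^ (-(σ + 1)) * ∑ j ∈ Finset.range J, (M + j) ^ (-σ - 1) ≤
      M ^ (-σ) - (M + J) ^ (-σ) := by
    induction J with
    | zero => simp
    | succ J ih =>
      rw [Finset.sum_range_succ, mul_add]
      have := rpow_neg_succ_le_sub hσ (by linarith [Nat.cast_nonneg (α := ℝ) J] : 1 ≤ M + J)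
      rw [add_assoc M] at this
      push_cast
      linarith
  have h0 : (0 : ℝ) ≤ (M + J) ^ (-σ) := by positivity
  rw [Real.rpow_neg (by norm_num)] at h
  have h2 : (0 : ℝ) < 2 ^ (σ + 1) := by positivity
  calc _ = 2 ^ (σ + 1) / σ * (σ * (2 ^ (σ + 1))⁻¹ *
        ∑ j ∈ Finset.range J, (M + j) ^ (-σ - 1)) := by field_simp
    _ ≤ _ := by gcongr; linarith

theorem summable_rpow_neg_succ {σ M : ℝ} (hσ : 0 < σ) (hM : 1 ≤ M) :
    Summable fun j : ℕ => (M + j) ^ (-σ - 1) :=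
  summable_of_sum_range_le (fun j => by positivity) (sum_range_rpow_neg_succ_le hσ hM)

theorem tsum_rpow_neg_succ_le {σ M : ℝ} (hσ : 0 < σ) (hM : 1 ≤ M) :
    ∑' j : ℕ, (M + j) ^ (-σ - 1) ≤ 2 ^ (σ + 1) / σ * M ^ (-σ) :=
  Real.tsum_le_of_sum_range_le (fun j => by positivity) (sum_range_rpow_neg_succ_le hσ hM)

/-- The regularized value of the tail `∑_{j ≥ 0} kernel s₁ s₃ a (M + j)`. -/
noncomputable def kernelTail (s₁ s₃ : ℂ) (a M : ℝ) : ℂ :=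
  kernelPrimitive s₁ s₃ a M + ∑' j : ℕ, kernelDefect s₁ s₃ a (M + j)

theorem norm_kernelDefect_add_le {s₁ s₃ : ℂ} (hσ : 0 < s₁.re + s₃.re) (hs : s₁ + s₃ ≠ 1)
    {a M : ℝ} (ha : 0 ≤ a) (haM : a ≤ M) (hM : 1 ≤ M) (j : ℕ) :
    ‖kernelDefect s₁ s₃ a (M + j)‖ ≤ 2 ^ |s₃.re| *
      (‖s₁‖ + ‖s₃‖ + ‖s₁‖ * a / ‖s₁ + s₃ - 1‖) * (M + j) ^ (-(s₁.re + s₃.re) - 1) :=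
  norm_kernelDefect_le hσ hs (by positivity) ha (by linarith [Nat.cast_nonneg (α := ℝ) j])

theorem summable_kernelDefect {s₁ s₃ : ℂ} (hσ : 0 < s₁.re + s₃.re) (hs : s₁ + s₃ ≠ 1)
    {a M : ℝ} (ha : 0 ≤ a) (haM : a ≤ M) (hM : 1 ≤ M) :
    Summable fun j : ℕ => kernelDefect s₁ s₃ a (M + j) :=
  .of_norm_bounded ((summable_rpow_neg_succ hσ hM).mul_left _)
    (norm_kernelDefect_add_le hσ hs ha haM hM)

/-- Splitting off the defect at `M` replaces the primitive at `M` by the kernel at `M` plus the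
primitive at `M + 1`. The regularized tail thus obeys the same recursion as a convergent one. -/
theorem kernelTail_eq_kernel_add {s₁ s₃ : ℂ} (hσ : 0 < s₁.re + s₃.re) (hs : s₁ + s₃ ≠ 1)
    {a M : ℝ} (ha : 0 ≤ a) (haM : a ≤ M) (hM : 1 ≤ M) :
    kernelTail s₁ s₃ a M = kernel s₁ s₃ a M + kernelTail s₁ s₃ a (M + 1) := by
  rw [kernelTail, (summable_kernelDefect hσ hs ha haM hM).tsum_eq_zero_add, kernelTail]
  simp only [Nat.cast_zero, add_zero, Nat.cast_succ]
  rw [tsum_congr fun j : ℕ => by rw [(by ring : M + (j + 1 : ℝ) = M + 1 + j)], kernelDefect]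
  ring

theorem kernelTail_eq_sum_add {s₁ s₃ : ℂ} (hσ : 0 < s₁.re + s₃.re) (hs : s₁ + s₃ ≠ 1)
    {a M : ℝ} (ha : 0 ≤ a) (haM : a ≤ M) (hM : 1 ≤ M) (J : ℕ) :
    kernelTail s₁ s₃ a M =
      ∑ j ∈ Finset.range J, kernel s₁ s₃ a (M + j) + kernelTail s₁ s₃ a (M + J) := by
  induction J with
  | zero => simp
  | succ J ih =>
    have hJ := Nat.cast_nonneg (α := ℝ) J
    rw [ih, Finset.sum_range_succ, kernelTail_eq_kernel_add hσ hs ha (by linarith : a ≤ M + J)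
      (by linarith)]
    push_cast
    rw [add_assoc M, add_assoc]

/-- A crude bound, growing with |s₃|, used for convergence and holomorphy. The constant is explicit
so that its continuity in (s₁, s₃) can be checked. -/
theorem norm_kernelTail_le {s₁ s₃ : ℂ} (hσ : 0 < s₁.re + s₃.re) (hs : s₁ + s₃ ≠ 1)
    {a M : ℝ} (ha : 0 ≤ a) (haM : a ≤ M) (hM : 1 ≤ M) :
    ‖kernelTail s₁ s₃ a M‖ ≤ (2 ^ |1 - s₃.re| / ‖s₁ + s₃ - 1‖ + 2 ^ |s₃.re| *
      (‖s₁‖ + ‖s₃‖ + ‖s₁‖ / ‖s₁ + s₃ - 1‖) * (2 ^ (s₁.re + s₃.re + 1) / (s₁.re + s₃.re))) *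
      M ^ (1 - (s₁.re + s₃.re)) := by
  have hM0 : 0 < M := by linarith
  have h1 := norm_kernelPrimitive_le s₁ s₃ hM0 ha haM
  have h2 : ‖∑' j : ℕ, kernelDefect s₁ s₃ a (M + j)‖ ≤ _ :=
    tsum_of_norm_bounded ((summable_rpow_neg_succ hσ hM).hasSum.mul_left _)
      (norm_kernelDefect_add_le hσ hs ha haM hM)
  have h3 := tsum_rpow_neg_succ_le hσ hM
  have h4 : ‖s₁‖ + ‖s₃‖ + ‖s₁‖ * a / ‖s₁ + s₃ - 1‖ ≤
      (‖s₁‖ + ‖s₃‖ + ‖s₁‖ / ‖s₁ + s₃ - 1‖) * M := by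
    have e1 : ‖s₁‖ * a / ‖s₁ + s₃ - 1‖ ≤ ‖s₁‖ / ‖s₁ + s₃ - 1‖ * M := by
      rw [mul_div_right_comm]; gcongr
    have e2 : ‖s₁‖ + ‖s₃‖ ≤ (‖s₁‖ + ‖s₃‖) * M := le_mul_of_one_le_right (by positivity) hM
    linarith
  have h5 : M ^ (1 - (s₁.re + s₃.re)) = M * M ^ (-(s₁.re + s₃.re)) := by
    rw [sub_eq_add_neg, Real.rpow_add hM0, Real.rpow_one]
  calc _ ≤ 2 ^ |1 - s₃.re| * M ^ (1 - (s₁.re + s₃.re)) / ‖s₁ + s₃ - 1‖ +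
        2 ^ |s₃.re| * ((‖s₁‖ + ‖s₃‖ + ‖s₁‖ / ‖s₁ + s₃ - 1‖) * M) *
          (2 ^ (s₁.re + s₃.re + 1) / (s₁.re + s₃.re) * M ^ (-(s₁.re + s₃.re))) := by
        refine (norm_add_le _ _).trans (add_le_add h1 (h2.trans ?_))
        gcongr
    _ = _ := by rw [h5]; ring

/-- Replacing the defect by the increment of `c (ω x) * kernel s₁ s₃ a x`, where `ω` is the
logarithmic derivative of the kernel and `c` a fixed function, saves a factor `1 / x`. -/
theorem exists_kernelDefect_approx : ∃ (c : ℂ → ℂ) (C : ℝ), 0 ≤ C ∧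
    (∀ z, ‖z‖ ≤ 1 / 2 → ‖c z‖ ≤ C) ∧
    ∀ (s₁ s₃ : ℂ) (a x : ℝ), 0 < s₁.re + s₃.re → s₁ + s₃ ≠ 1 → 0 ≤ a → a ≤ x → 1 ≤ x →
      2 * (‖s₁‖ + ‖s₃‖) ≤ x → kernelLogDeriv s₁ s₃ a x ≠ 0 →
      ‖kernelDefect s₁ s₃ a x - (c (kernelLogDeriv s₁ s₃ a (x + 1)) * kernel s₁ s₃ a (x + 1) -
        c (kernelLogDeriv s₁ s₃ a x) * kernel s₁ s₃ a x)‖ ≤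
      C * ((2 ^ |s₃.re| * x ^ (-(s₁.re + s₃.re))) *
        ((‖s₁‖ + ‖s₃‖) / x ^ 2 + ‖s₁‖ * a / ‖s₁ + s₃ - 1‖ / x)) := by
  obtain ⟨c, C, hC0, hc, hcb, hcl⟩ := exists_euler_maclaurin_multiplier
  refine ⟨c, 4 + 5 * C, by positivity, fun z hz => (hcb z hz).trans (by linarith), ?_⟩
  intro s₁ s₃ a x hσ hs ha hax hx1 hAx hω0
  have hx : 0 < x := by linarith
  set A : ℝ := ‖s₁‖ + ‖s₃‖ with hA
  set G : ℝ := 2 ^ |s₃.re| * x ^ (-(s₁.re + s₃.re)) with hG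
  set ω : ℂ := kernelLogDeriv s₁ s₃ a x with hω
  have hA0 : 0 ≤ A := by positivity
  have hG0 : 0 ≤ G := by positivity
  have hωb : ∀ y, x ≤ y → ‖kernelLogDeriv s₁ s₃ a y‖ ≤ 1 / 2 := by
    intro y hy
    refine (norm_kernelLogDeriv_le s₁ s₃ (by linarith) ha).trans ?_
    rw [div_le_iff₀ (by linarith)]
    linarith
  have hexp : ∀ z : ℂ, ‖z‖ ≤ 1 / 2 → ‖Complex.exp z‖ ≤ 2 := by
    intro z hz
    rw [Complex.norm_exp]
    refine (Real.exp_le_exp.2 ((Complex.re_le_norm z).trans hz)).trans ?_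
    have := Real.exp_bound_div_one_sub_of_interval (x := 1 / 2) (by norm_num) (by norm_num)
    linarith
  have hωu : ∀ u ∈ Set.Icc (0 : ℝ) 1, ‖ω * u‖ ≤ 1 / 2 := by
    intro u hu
    rw [norm_mul, Complex.norm_real, Real.norm_of_nonneg hu.1]
    nlinarith [hωb x le_rfl, hu.1, hu.2, norm_nonneg ω]
  have hd : ∀ u : ℝ, HasDerivAt (fun u : ℝ => Complex.exp (ω * u)) (Complex.exp (ω * u) * ω) u := by
    intro u
    simpa using ((hasDerivAt_id u).ofReal_comp.const_mul ω).cexp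
  have hd' : ∀ u : ℝ,
      HasDerivAt (fun u : ℝ => Complex.exp (-ω * u)) (Complex.exp (-ω * u) * -ω) u := by
    intro u
    simpa using ((hasDerivAt_id u).ofReal_comp.const_mul (-ω)).cexp
  -- The derivative of k(x+u) exp(-ωu) contains the factor ω(x+u) - ω(x) = O(A/x²), so the kernel is
  -- locally exponential to that precision.
  have hg : ∀ u ∈ Set.Icc (0 : ℝ) 1,
      ‖kernel s₁ s₃ a (x + u) - kernel s₁ s₃ a x * Complex.exp (ω * u)‖ ≤ 4 * G * (A / x ^ 2) := by
    intro u hu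
    have h := norm_image_one_sub_le
      (f := fun u => kernel s₁ s₃ a (x + u) * Complex.exp (-ω * u)) (C := G * 2 * (A / x ^ 2))
      (fun u hu => ((hasDerivAt_kernel s₁ s₃ (by linarith [hu.1]) ha).comp_const_add x u).mul
        (hd' u))
      (fun u hu => by
        have h1 := norm_kernelLogDeriv_sub_le s₁ s₃ hx ha hu.1 hu.2
        have h2 := norm_kernel_add_le hσ hx ha hax hu.1
        have h3 := hexp (-ω * u) (by rw [neg_mul, norm_neg]; exact hωu u hu)
        rw [(by ring : kernel s₁ s₃ a (x + u) * kernelLogDeriv s₁ s₃ a (x + u) *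
          Complex.exp (-ω * u) + kernel s₁ s₃ a (x + u) * (Complex.exp (-ω * u) * -ω) =
          kernel s₁ s₃ a (x + u) * Complex.exp (-ω * u) * (kernelLogDeriv s₁ s₃ a (x + u) - ω)),
          norm_mul, norm_mul]
        gcongr) u hu
    have h1 : kernel s₁ s₃ a (x + u) - kernel s₁ s₃ a x * Complex.exp (ω * u) =
        Complex.exp (ω * u) * (kernel s₁ s₃ a (x + u) * Complex.exp (-ω * u) -
          kernel s₁ s₃ a (x + 0) * Complex.exp (-ω * (0 : ℝ))) := by
      have : Complex.exp (ω * u) * Complex.exp (-ω * u) = 1 := by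
        rw [← Complex.exp_add]; simp
      simp only [add_zero, Complex.ofReal_zero, mul_zero, Complex.exp_zero, mul_one]
      linear_combination -kernel s₁ s₃ a (x + u) * this
    rw [h1, norm_mul]
    calc _ ≤ 2 * (G * 2 * (A / x ^ 2)) := mul_le_mul (hexp _ (hωu u hu)) h (norm_nonneg _) (by norm_num)
      _ = _ := by ring
  -- Integrating the exponential model gives k(x)(exp ω - 1)/ω as the approximate decrement of the
  -- primitive. This is where ω ≠ 0 is needed.
  have hQ := norm_image_one_sub_le
    (f := fun u => kernelPrimitive s₁ s₃ a (x + u) +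
      kernel s₁ s₃ a x * (Complex.exp (ω * u) / ω))
    (C := 4 * G * (A / x ^ 2) + ‖s₁‖ * a / ‖s₁ + s₃ - 1‖ / x * G)
    (fun u hu => ((hasDerivAt_kernelPrimitive hs (by linarith [hu.1]) ha).comp_const_add x u).add
      (((hd u).div_const ω).const_mul (kernel s₁ s₃ a x)))
    (fun u hu => by
      have h1 := hg u hu
      rw [norm_sub_rev] at h1
      have h2 := norm_mul_div_mul_kernel_le (s₁ := s₁) (s₃ := s₃) hσ hx ha hax hu.1
      refine le_trans (le_of_eq ?_) ((norm_sub_le _ _).trans (add_le_add h1 h2))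
      congr 1
      rw [mul_div_cancel_right₀ _ hω0]
      ring) 1 ⟨by norm_num, le_rfl⟩
  have hg1 := hg 1 ⟨by norm_num, le_rfl⟩
  simp only [add_zero, Complex.ofReal_one, mul_one, Complex.ofReal_zero, mul_zero,
    Complex.exp_zero] at hQ hg1
  have hmul := hc ω hω0 (hωb x le_rfl)
  -- By the equation for c, k(x)(1 - (exp ω - 1)/ω) = c(ω)(k(x) exp ω - k(x)). The three errors come
  -- from the primitive, from replacing k(x) exp ω by k(x+1), and from moving ω from x to x+1.
  have key : kernelDefect s₁ s₃ a x - (c (kernelLogDeriv s₁ s₃ a (x + 1)) *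
        kernel s₁ s₃ a (x + 1) - c ω * kernel s₁ s₃ a x) =
      (kernelPrimitive s₁ s₃ a (x + 1) + kernel s₁ s₃ a x * (Complex.exp ω / ω) -
        (kernelPrimitive s₁ s₃ a x + kernel s₁ s₃ a x * (1 / ω))) -
      c ω * (kernel s₁ s₃ a (x + 1) - kernel s₁ s₃ a x * Complex.exp ω) +
      (c ω - c (kernelLogDeriv s₁ s₃ a (x + 1))) * kernel s₁ s₃ a (x + 1) := by
    rw [kernelDefect]
    linear_combination -kernel s₁ s₃ a x * hmul
  have hC1 : ‖c ω * (kernel s₁ s₃ a (x + 1) - kernel s₁ s₃ a x * Complex.exp ω)‖ ≤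
      C * (4 * G * (A / x ^ 2)) := by
    rw [norm_mul]
    exact mul_le_mul (hcb _ (hωb x le_rfl)) hg1 (norm_nonneg _) hC0
  have hC2 : ‖(c ω - c (kernelLogDeriv s₁ s₃ a (x + 1))) * kernel s₁ s₃ a (x + 1)‖ ≤
      C * (A / x ^ 2) * G := by
    rw [norm_mul]
    have h1 := hcl ω (kernelLogDeriv s₁ s₃ a (x + 1)) (hωb x le_rfl) (hωb _ (by linarith))
    have h2 := norm_kernelLogDeriv_sub_le s₁ s₃ hx ha zero_le_one le_rfl
    rw [norm_sub_rev] at h2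
    exact mul_le_mul (h1.trans (mul_le_mul_of_nonneg_left h2 hC0))
      (norm_kernel_add_le hσ hx ha hax zero_le_one) (norm_nonneg _) (by positivity)
  rw [key]
  have hB : 0 ≤ C * (‖s₁‖ * a / ‖s₁ + s₃ - 1‖ / x * G) := by positivity
  have hB' : 0 ≤ ‖s₁‖ * a / ‖s₁ + s₃ - 1‖ / x * G := by positivity
  refine ((norm_add_le _ _).trans (add_le_add_left (norm_sub_le _ _) _)).trans ?_
  nlinarith

/-- Under these sign conditions the imaginary part is strictly negative: the two contributions
cannot cancel. -/
theorem kernelLogDeriv_ne_zero {s₁ s₃ : ℂ} (h₁ : 0 ≤ s₁.im) (h₃ : 0 < s₃.im) {a x : ℝ}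
    (hx : 0 < x) (ha : 0 ≤ a) : kernelLogDeriv s₁ s₃ a x ≠ 0 := by
  intro h
  have h2 := congrArg Complex.im h
  rw [kernelLogDeriv, Complex.add_im, Complex.div_ofReal_im, Complex.div_ofReal_im] at h2
  simp only [Complex.neg_im, Complex.zero_im, neg_div] at h2
  have e1 : 0 ≤ s₁.im / x := by positivity
  have e2 : 0 < s₃.im / (x + a) := by positivity
  linarith

/-- The tail is `O (M ^ (1 - Re (s₁ + s₃)) / Im s₃)` once `M` exceeds a multiple of `Im s₃`. -/
theorem exists_norm_kernelTail_le {s₁ : ℂ} {σ₃ : ℝ} (hσ : 0 < s₁.re + σ₃) (ht₁ : 0 ≤ s₁.im) :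
    ∃ C : ℝ, 0 ≤ C ∧ ∀ (s₃ : ℂ) (a M : ℝ), s₃.re = σ₃ → 0 < s₃.im → 0 ≤ a → a ≤ M → 1 ≤ M →
      2 * (‖s₁‖ + ‖s₃‖) ≤ M →
      ‖kernelTail s₁ s₃ a M‖ ≤ C * (M ^ (1 - (s₁.re + σ₃)) / s₃.im) := by
  obtain ⟨c, C, hC0, hcb, happ⟩ := exists_kernelDefect_approx
  set K : ℝ := 2 ^ (s₁.re + σ₃ + 1) / (s₁.re + σ₃) with hK
  refine ⟨2 ^ |1 - σ₃| + 2 ^ |σ₃| * (2 * C + C * ((1 / 2 + ‖s₁‖) * K)), by positivity, ?_⟩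
  rintro s₃ a M rfl ht ha haM hM hAM
  have hM0 : 0 < M := by linarith
  have htn : s₃.im ≤ ‖s₁ + s₃ - 1‖ := by
    have h1 := Complex.abs_im_le_norm (s₁ + s₃ - 1)
    simp only [Complex.sub_im, Complex.add_im, Complex.one_im, sub_zero] at h1
    linarith [le_abs_self (s₁.im + s₃.im)]
  have hs : s₁ + s₃ ≠ 1 := by
    intro h
    rw [h, sub_self, norm_zero] at htn
    linarith
  have htM : s₃.im ≤ M := by
    have := (le_abs_self _).trans (Complex.abs_im_le_norm s₃)
    have := norm_nonneg s₁
    have := norm_nonneg s₃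
    linarith
  set σ : ℝ := s₁.re + s₃.re with hσd
  set g : ℕ → ℂ := fun j => c (kernelLogDeriv s₁ s₃ a (M + j)) * kernel s₁ s₃ a (M + j) with hg
  have hgb : ∀ j, ‖g j‖ ≤ C * (2 ^ |s₃.re| * M ^ (-σ)) := by
    intro j
    have hj := Nat.cast_nonneg (α := ℝ) j
    rw [hg, norm_mul]
    refine mul_le_mul (hcb _ ?_) (norm_kernel_add_le hσ hM0 ha haM hj) (norm_nonneg _) hC0
    refine (norm_kernelLogDeriv_le s₁ s₃ (by linarith) ha).trans ?_
    rw [div_le_iff₀ (by linarith)]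
    linarith
  have hB : ‖s₁‖ * a / ‖s₁ + s₃ - 1‖ ≤ ‖s₁‖ * (M / s₃.im) := by
    rw [← mul_div_assoc]
    gcongr
  have hMt : 1 ≤ M / s₃.im := (one_le_div ht).2 htM
  -- From 2(|s₁| + |s₃|) ≤ M, the A/x² error is at most 1/(2x). The error of the primitive is at
  -- most |s₁|(M/t)/x because a ≤ M. As M/t ≥ 1, both are O((M/t)/x).
  have herr : ∀ j : ℕ, ‖kernelDefect s₁ s₃ a (M + j) - (g (j + 1) - g j)‖ ≤
      C * 2 ^ |s₃.re| * ((1 / 2 + ‖s₁‖) * (M / s₃.im)) * (M + j) ^ (-σ - 1) := by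
    intro j
    have hj := Nat.cast_nonneg (α := ℝ) j
    have hMj : 0 < M + j := by linarith
    have h := happ s₁ s₃ a (M + j) hσ hs ha (by linarith) (by linarith) (by linarith)
      (kernelLogDeriv_ne_zero ht₁ ht hMj ha)
    rw [add_assoc M, ← Nat.cast_succ] at h
    refine h.trans ?_
    have h1 : (‖s₁‖ + ‖s₃‖) / (M + j) ^ 2 ≤ 1 / 2 / (M + j) := by
      rw [div_div, div_le_div_iff₀ (by positivity) (by positivity)]
      nlinarith
    have h2 : (‖s₁‖ + ‖s₃‖) / (M + j) ^ 2 + ‖s₁‖ * a / ‖s₁ + s₃ - 1‖ / (M + j) ≤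
        (1 / 2 + ‖s₁‖) * (M / s₃.im) / (M + j) := by
      calc _ ≤ 1 / 2 * (M / s₃.im) / (M + j) + ‖s₁‖ * (M / s₃.im) / (M + j) := by
            refine add_le_add (h1.trans ?_) ?_
            · gcongr; linarith
            · gcongr
        _ = _ := by ring
    rw [Real.rpow_sub_one hMj.ne']
    calc _ ≤ C * (2 ^ |s₃.re| * (M + j) ^ (-σ) * ((1 / 2 + ‖s₁‖) * (M / s₃.im) / (M + j))) := by
          gcongr
      _ = _ := by ring
  -- The main parts of the defects oscillate, so partial sums are bounded by telescoping instead of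
  -- absolute values, and the limit is taken afterwards.
  have hpart : ∀ J : ℕ, ‖∑ j ∈ Finset.range J, kernelDefect s₁ s₃ a (M + j)‖ ≤
      2 ^ |s₃.re| * (2 * C + C * ((1 / 2 + ‖s₁‖) * K)) * (M ^ (1 - σ) / s₃.im) := by
    intro J
    have e : ∑ j ∈ Finset.range J, kernelDefect s₁ s₃ a (M + j) = (g J - g 0) +
        ∑ j ∈ Finset.range J, (kernelDefect s₁ s₃ a (M + j) - (g (j + 1) - g j)) := by
      rw [Finset.sum_sub_distrib, Finset.sum_range_sub]
      ring
    have h1 : ‖∑ j ∈ Finset.range J, (kernelDefect s₁ s₃ a (M + j) - (g (j + 1) - g j))‖ ≤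
        C * 2 ^ |s₃.re| * ((1 / 2 + ‖s₁‖) * (M / s₃.im)) * (K * M ^ (-σ)) := by
      refine (norm_sum_le _ _).trans ((Finset.sum_le_sum fun j _ => herr j).trans ?_)
      rw [← Finset.mul_sum]
      exact mul_le_mul_of_nonneg_left (sum_range_rpow_neg_succ_le hσ hM J) (by positivity)
    have h2 : C * (2 ^ |s₃.re| * M ^ (-σ)) ≤ C * (2 ^ |s₃.re| * (M ^ (-σ) * (M / s₃.im))) := by
      gcongr
      exact le_mul_of_one_le_right (by positivity) hMt
    have h5 : M ^ (1 - σ) / s₃.im = M ^ (-σ) * (M / s₃.im) := by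
      rw [sub_eq_add_neg, Real.rpow_add hM0, Real.rpow_one]
      ring
    rw [e, h5]
    refine (norm_add_le _ _).trans ((add_le_add ((norm_sub_le _ _).trans
      (add_le_add ((hgb J).trans h2) ((hgb 0).trans h2))) h1).trans (le_of_eq ?_))
    ring
  have hlim := le_of_tendsto
    (summable_kernelDefect hσ hs ha haM hM).hasSum.tendsto_sum_nat.norm
    (Filter.Eventually.of_forall hpart)
  have hP : ‖kernelPrimitive s₁ s₃ a M‖ ≤ 2 ^ |1 - s₃.re| * (M ^ (1 - σ) / s₃.im) := by
    refine (norm_kernelPrimitive_le s₁ s₃ hM0 ha haM).trans ?_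
    rw [← mul_div_assoc]
    gcongr
  rw [kernelTail, add_mul]
  exact (norm_add_le _ _).trans (add_le_add hP hlim)

/-! ### Series of holomorphic functions on a complex normed space -/

/-- Cauchy's estimate on the complex line through `p` in each direction `v`. The radius 2r leaves
room for the closed disc of radius r. -/
theorem norm_fderiv_le_div_of_norm_le {E : Type*} [NormedAddCommGroup E] [NormedSpace ℂ E]
    {f : E → ℂ} {p : E} {r M : ℝ} (hr : 0 < r)
    (hf : DifferentiableOn ℂ f (Metric.ball p (2 * r)))
    (hM : ∀ q ∈ Metric.ball p (2 * r), ‖f q‖ ≤ M) : ‖fderiv ℂ f p‖ ≤ M / r := by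
  have hp : p ∈ Metric.ball p (2 * r) := Metric.mem_ball_self (by positivity)
  have hM0 : 0 ≤ M := (norm_nonneg _).trans (hM p hp)
  refine ContinuousLinearMap.opNorm_le_bound _ (by positivity) fun v => ?_
  rcases eq_or_ne v 0 with rfl | hv
  · simp
  have hv0 : 0 < ‖v‖ := norm_pos_iff.2 hv
  have hmem : ∀ z ∈ Metric.closedBall (0 : ℂ) (r / ‖v‖), p + z • v ∈ Metric.ball p (2 * r) := by
    intro z hz
    rw [mem_closedBall_zero_iff, le_div_iff₀ hv0] at hz
    rw [mem_ball_iff_norm, add_sub_cancel_left, norm_smul]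
    linarith
  have hline : ∀ z : ℂ, HasDerivAt (fun z : ℂ => p + z • v) v z := fun z => by
    simpa using ((hasDerivAt_id z).smul_const v).const_add p
  have hdiff : ∀ z ∈ Metric.closedBall (0 : ℂ) (r / ‖v‖),
      HasDerivAt (fun z : ℂ => f (p + z • v)) (fderiv ℂ f (p + z • v) v) z := fun z hz =>
    (hf.differentiableAt (Metric.isOpen_ball.mem_nhds (hmem z hz))).hasFDerivAt.comp_hasDerivAt z
      (hline z)
  have h0 := (hdiff 0 (Metric.mem_closedBall_self (by positivity))).deriv
  rw [zero_smul, add_zero] at h0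
  rw [← h0]
  refine (Complex.norm_deriv_le_of_forall_mem_sphere_norm_le (C := M) (div_pos hr hv0) ?_
    fun z hz => hM _ (hmem z (Metric.sphere_subset_closedBall hz))).trans (le_of_eq ?_)
  · refine DifferentiableOn.diffContOnCl fun z hz => ?_
    exact (hdiff z (Metric.closure_ball_subset_closedBall hz)).differentiableAt.differentiableWithinAt
  · field_simp

/-- Cauchy's estimate turns the uniform bound on the terms into a summable bound on their
derivatives over a smaller ball, which permits termwise differentiation in several variables. -/
theorem differentiableOn_tsum_of_norm_le {E : Type*} [NormedAddCommGroup E] [NormedSpace ℂ E]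
    {f : ℕ → E → ℂ} {u : ℕ → ℝ} (hu : Summable u) {s : Set E} (hs : IsOpen s)
    (hf : ∀ n, DifferentiableOn ℂ (f n) s) (hb : ∀ n, ∀ p ∈ s, ‖f n p‖ ≤ u n) :
    DifferentiableOn ℂ (fun p => ∑' n, f n p) s := by
  intro p hp
  obtain ⟨ε, hε, hεs⟩ := Metric.isOpen_iff.1 hs p hp
  have hsub : ∀ q ∈ Metric.ball p (ε / 2), Metric.ball q (2 * (ε / 4)) ⊆ s := fun q hq =>
    (Metric.ball_subset_ball' (by linarith [Metric.mem_ball.1 hq])).trans hεs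
  have hp' : p ∈ Metric.ball p (ε / 2) := Metric.mem_ball_self (by positivity)
  have hpre : IsPreconnected (Metric.ball p (ε / 2)) := by
    let : NormedSpace ℝ E := NormedSpace.restrictScalars ℝ ℂ E
    exact (convex_ball p (ε / 2)).isPreconnected
  have := hasFDerivAt_tsum_of_isPreconnected (f := f) (f' := fun n q => fderiv ℂ (f n) q)
    (u := fun n => u n / (ε / 4)) (hu.div_const _) (Metric.isOpen_ball (x := p) (ε := ε / 2)) hpre
    (fun n q hq => ((hf n).differentiableAt (hs.mem_nhds
      (hsub q hq (Metric.mem_ball_self (by positivity))))).hasFDerivAt)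
    (fun n q hq => norm_fderiv_le_div_of_norm_le (by positivity) ((hf n).mono (hsub q hq))
      fun q' hq' => hb n q' (hsub q hq hq'))
    hp' (Summable.of_norm_bounded hu fun n => hb n p hp) hp'
  exact this.differentiableAt.differentiableWithinAt

/-- Near each point a fixed exponent between 1 and `e p` and a fixed constant above `K p` provide a
summable majorant. -/
theorem differentiableOn_tsum_of_norm_le_rpow {E : Type*} [NormedAddCommGroup E] [NormedSpace ℂ E]
    {f : ℕ → E → ℂ} {s : Set E} (hs : IsOpen s) {K e : E → ℝ} (hK : ContinuousOn K s)
    (he : ContinuousOn e s) (he1 : ∀ p ∈ s, 1 < e p) (hf : ∀ n, DifferentiableOn ℂ (f n) s)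
    (hb : ∀ n, ∀ p ∈ s, ‖f n p‖ ≤ K p * ((n : ℝ) + 1) ^ (-e p)) :
    DifferentiableOn ℂ (fun p => ∑' n, f n p) s := by
  intro p hp
  obtain ⟨e', h1, h2⟩ := exists_between (he1 p hp)
  have hev : ∀ᶠ q in nhds p, q ∈ s ∧ K q < |K p| + 1 ∧ e' < e q := by
    filter_upwards [hs.mem_nhds hp,
      (hK.continuousAt (hs.mem_nhds hp)).eventually_lt_const
        ((le_abs_self (K p)).trans_lt (lt_add_one _)),
      (he.continuousAt (hs.mem_nhds hp)).eventually_const_lt h2] with q a b c using ⟨a, b, c⟩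
  obtain ⟨U, hU, hUo, hpU⟩ := eventually_nhds_iff.1 hev
  have hsum : Summable fun n : ℕ => (|K p| + 1) * ((n : ℝ) + 1) ^ (-e') := by
    refine Summable.mul_left _ ?_
    have := (summable_nat_add_iff 1).2 (Real.summable_nat_rpow.2 (by linarith : -e' < -1))
    simpa using this
  refine ((differentiableOn_tsum_of_norm_le hsum hUo (fun n => (hf n).mono fun q hq => (hU q hq).1)
    fun n q hq => ?_).differentiableAt (hUo.mem_nhds hpU)).differentiableWithinAt
  obtain ⟨hqs, hqK, hqe⟩ := hU q hq
  refine (hb n q hqs).trans ?_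
  refine mul_le_mul hqK.le ?_ (by positivity) (by positivity)
  exact Real.rpow_le_rpow_of_exponent_le (by linarith [Nat.cast_nonneg (α := ℝ) n]) (by linarith)

/-! ### The analytic continuation of the Apostol-Vu double series -/

theorem isOpen_apostolVuDomain : IsOpen apostolVuDomain := by
  have h1 : IsOpen {p : ℂ × ℂ × ℂ | 0 < (p.1 + p.2.2).re} :=
    isOpen_lt continuous_const (by fun_prop)
  have h2 : IsOpen {p : ℂ × ℂ × ℂ | 2 < (p.1 + p.2.1 + p.2.2).re} :=
    isOpen_lt continuous_const (by fun_prop)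
  have h3 : IsOpen {p : ℂ × ℂ × ℂ | p.1 + p.2.2 ≠ 1} :=
    isOpen_ne_fun (by fun_prop) continuous_const
  exact h1.inter (h2.inter h3)

theorem continuous_const_rpow {X : Type*} [TopologicalSpace X] {b : ℝ} (hb : 0 < b) {h : X → ℝ}
    (hh : Continuous h) : Continuous fun x => b ^ h x :=
  continuous_const.rpow hh fun _ => Or.inl hb.ne'

theorem differentiableOn_kernel (a x : ℝ) (hx : 0 < x) (ha : 0 ≤ a) (s : Set (ℂ × ℂ × ℂ)) :
    DifferentiableOn ℂ (fun p => kernel p.1 p.2.2 a x) s := by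
  have h1 : (x : ℂ) ≠ 0 := by exact_mod_cast hx.ne'
  have h2 : ((x + a : ℝ) : ℂ) ≠ 0 := by exact_mod_cast (by linarith : 0 < x + a).ne'
  unfold kernel
  exact (DifferentiableOn.const_cpow (by fun_prop) (Or.inl h1)).mul
    (DifferentiableOn.const_cpow (by fun_prop) (Or.inl h2))

theorem differentiableOn_kernelPrimitive (a x : ℝ) (hx : 0 < x) (ha : 0 ≤ a) :
    DifferentiableOn ℂ (fun p => kernelPrimitive p.1 p.2.2 a x) apostolVuDomain := by
  have h1 : (x : ℂ) ≠ 0 := by exact_mod_cast hx.ne'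
  have h2 : ((x + a : ℝ) : ℂ) ≠ 0 := by exact_mod_cast (by linarith : 0 < x + a).ne'
  unfold kernelPrimitive
  have h3 : DifferentiableOn ℂ (fun p : ℂ × ℂ × ℂ => (x : ℂ) ^ (-p.1)) apostolVuDomain :=
    DifferentiableOn.const_cpow (by fun_prop) (Or.inl h1)
  have h4 : DifferentiableOn ℂ (fun p : ℂ × ℂ × ℂ => ((x + a : ℝ) : ℂ) ^ (1 - p.2.2))
      apostolVuDomain := DifferentiableOn.const_cpow (by fun_prop) (Or.inl h2)
  have h5 : DifferentiableOn ℂ (fun p : ℂ × ℂ × ℂ => p.1 + p.2.2 - 1) apostolVuDomain := by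
    fun_prop
  simp only [div_eq_mul_inv]
  exact (h3.mul h4).mul (h5.inv fun p hp => sub_ne_zero.2 hp.2.2)

theorem differentiableOn_kernelTail (a M : ℝ) (ha : 0 ≤ a) (haM : a ≤ M) (hM : 1 ≤ M) :
    DifferentiableOn ℂ (fun p => kernelTail p.1 p.2.2 a M) apostolVuDomain := by
  unfold kernelTail
  have hj : ∀ j : ℕ, 0 < M + j := fun j => by linarith [Nat.cast_nonneg (α := ℝ) j]
  refine (differentiableOn_kernelPrimitive a M (by linarith) ha).add
    (differentiableOn_tsum_of_norm_le_rpow isOpen_apostolVuDomain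
    (K := fun p => 2 ^ |p.2.2.re| * (‖p.1‖ + ‖p.2.2‖ + ‖p.1‖ * a / ‖p.1 + p.2.2 - 1‖))
    (e := fun p => p.1.re + p.2.2.re + 1) ?_ (by fun_prop) (fun p hp => ?_) (fun j => ?_)
    fun j p hp => ?_)
  · refine (continuous_const_rpow (by norm_num) (by fun_prop)).continuousOn.mul
      (ContinuousOn.add (by fun_prop) (ContinuousOn.div (by fun_prop) (by fun_prop) fun p hp => ?_))
    exact norm_ne_zero_iff.2 (sub_ne_zero.2 hp.2.2)
  · have := hp.1
    rw [Complex.add_re] at this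
    linarith
  · unfold kernelDefect
    exact ((differentiableOn_kernel a _ (hj j) ha _).add
      (differentiableOn_kernelPrimitive a _ (by linarith [hj j]) ha)).sub
      (differentiableOn_kernelPrimitive a _ (hj j) ha)
  · have h1 := hp.1
    rw [Complex.add_re] at h1
    refine (norm_kernelDefect_add_le h1 hp.2.2 ha haM hM j).trans ?_
    refine mul_le_mul_of_nonneg_left ?_ (by positivity)
    rw [(by ring : -(p.1.re + p.2.2.re + 1) = -(p.1.re + p.2.2.re) - 1)]
    exact Real.rpow_le_rpow_of_nonpos (by positivity) (by linarith) (by linarith)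

/-- The `n`-th term of the series over `n` defining the analytic continuation of the Apostol-Vu
double zeta-function. -/
noncomputable def apostolVuTerm (p : ℂ × ℂ × ℂ) (n : ℕ) : ℂ :=
  ((n + 1 : ℝ) : ℂ) ^ (-p.2.1) * kernelTail p.1 p.2.2 (n + 1) (n + 2)

/-- An explicit analytic continuation of the Apostol-Vu double series. -/
noncomputable def apostolVuContinuation (p : ℂ × ℂ × ℂ) : ℂ :=
  ∑' n : ℕ, apostolVuTerm p n

/-- The constant, depending continuously on the point, in the bound for `apostolVuTerm`. -/
noncomputable def apostolVuTermConst (p : ℂ × ℂ × ℂ) : ℝ :=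
  (2 ^ |1 - p.2.2.re| / ‖p.1 + p.2.2 - 1‖ + 2 ^ |p.2.2.re| *
      (‖p.1‖ + ‖p.2.2‖ + ‖p.1‖ / ‖p.1 + p.2.2 - 1‖) *
      (2 ^ (p.1.re + p.2.2.re + 1) / (p.1.re + p.2.2.re))) * 2 ^ |1 - (p.1.re + p.2.2.re)|

theorem norm_apostolVuTerm_le {p : ℂ × ℂ × ℂ} (hp : p ∈ apostolVuDomain) (n : ℕ) :
    ‖apostolVuTerm p n‖ ≤
      apostolVuTermConst p * ((n : ℝ) + 1) ^ (-(p.1.re + p.2.1.re + p.2.2.re - 1)) := by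
  have hσ := hp.1
  rw [Complex.add_re] at hσ
  have hn : (0 : ℝ) < n + 1 := by positivity
  have h := norm_kernelTail_le hσ hp.2.2 hn.le (by linarith : (n + 1 : ℝ) ≤ n + 2) (by linarith)
  rw [apostolVuTerm, norm_mul, Complex.norm_cpow_eq_rpow_re_of_pos hn, apostolVuTermConst,
    (by rw [Complex.neg_re]; ring : -(p.1.re + p.2.1.re + p.2.2.re - 1) =
      (-p.2.1).re + (1 - (p.1.re + p.2.2.re))), Real.rpow_add hn]
  have h2 := rpow_le_two_rpow_abs_mul hn (by linarith : (n + 1 : ℝ) ≤ n + 2) (by linarith)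
    (1 - (p.1.re + p.2.2.re))
  have h3 := h.trans (mul_le_mul_of_nonneg_left h2 (by positivity))
  refine (mul_le_mul_of_nonneg_left h3 (by positivity)).trans (le_of_eq ?_)
  ring

theorem summable_natCast_add_one_rpow {e : ℝ} (he : 1 < e) :
    Summable fun n : ℕ => ((n : ℝ) + 1) ^ (-e) := by
  simpa using (summable_nat_add_iff 1).2 (Real.summable_nat_rpow.2 (by linarith : -e < -1))

theorem summable_apostolVuTerm {p : ℂ × ℂ × ℂ} (hp : p ∈ apostolVuDomain) :
    Summable (apostolVuTerm p) := by
  refine .of_norm_bounded ((summable_natCast_add_one_rpow ?_).mul_left _) (norm_apostolVuTerm_le hp)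
  have := hp.2.1
  simp only [Complex.add_re] at this
  linarith

theorem differentiableOn_apostolVuContinuation :
    DifferentiableOn ℂ apostolVuContinuation apostolVuDomain := by
  refine differentiableOn_tsum_of_norm_le_rpow (f := fun n p => apostolVuTerm p n)
    isOpen_apostolVuDomain
    (K := apostolVuTermConst) (e := fun p => p.1.re + p.2.1.re + p.2.2.re - 1) ?_
    (by fun_prop) (fun p hp => ?_) (fun n => ?_) fun n p hp => norm_apostolVuTerm_le hp n
  · have h0 : ∀ p ∈ apostolVuDomain, ‖p.1 + p.2.2 - 1‖ ≠ 0 := fun p hp =>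
      norm_ne_zero_iff.2 (sub_ne_zero.2 hp.2.2)
    have h1 : ∀ p ∈ apostolVuDomain, p.1.re + p.2.2.re ≠ 0 := fun p hp => by
      rw [← Complex.add_re]
      exact hp.1.ne'
    have hc : ∀ {h : ℂ × ℂ × ℂ → ℝ}, Continuous h →
        ContinuousOn (fun p => (2 : ℝ) ^ h p) apostolVuDomain := fun hh =>
      (continuous_const_rpow (by norm_num) hh).continuousOn
    unfold apostolVuTermConst
    refine ContinuousOn.mul (ContinuousOn.add ?_ (ContinuousOn.mul (ContinuousOn.mul ?_
      (ContinuousOn.add (by fun_prop) ?_)) ?_)) (hc (by fun_prop))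
    · exact (hc (by fun_prop)).div (by fun_prop) h0
    · exact hc (by fun_prop)
    · exact ContinuousOn.div (by fun_prop) (by fun_prop) h0
    · exact (hc (by fun_prop)).div (by fun_prop) h1
  · have := hp.2.1
    simp only [Complex.add_re] at this
    linarith
  · have hn : (0 : ℝ) < n + 1 := by positivity
    have h1 : ((n + 1 : ℝ) : ℂ) ≠ 0 := by exact_mod_cast hn.ne'
    exact (DifferentiableOn.const_cpow (by fun_prop) (Or.inl h1)).mul
      (differentiableOn_kernelTail _ _ hn.le (by linarith) (by linarith))

/-- When σ > 1 the remainder `kernelTail s₁ s₃ a (M + J)` is O((M+J)^(1-σ)) and tends to 0. -/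
theorem hasSum_kernel {s₁ s₃ : ℂ} (hσ : 1 < s₁.re + s₃.re) {a M : ℝ} (ha : 0 ≤ a) (haM : a ≤ M)
    (hM : 1 ≤ M) : HasSum (fun j : ℕ => kernel s₁ s₃ a (M + j)) (kernelTail s₁ s₃ a M) := by
  have hs : s₁ + s₃ ≠ 1 := by
    intro h
    have := congrArg Complex.re h
    rw [Complex.add_re, Complex.one_re] at this
    linarith
  have hsum : Summable fun j : ℕ => kernel s₁ s₃ a (M + j) := by
    refine .of_norm_bounded ((summable_rpow_neg_succ
      (σ := s₁.re + s₃.re - 1) (by linarith) hM).mul_left (2 ^ |s₃.re|)) fun j => ?_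
    have hj := Nat.cast_nonneg (α := ℝ) j
    rw [(by ring : -(s₁.re + s₃.re - 1) - 1 = -(s₁.re + s₃.re))]
    exact norm_kernel_le s₁ s₃ (by linarith) ha (by linarith)
  rw [hsum.hasSum_iff_tendsto_nat]
  have htail : Filter.Tendsto (fun J : ℕ => kernelTail s₁ s₃ a (M + J)) Filter.atTop (nhds 0) := by
    refine squeeze_zero_norm (fun J => norm_kernelTail_le (by linarith) hs ha
      (by linarith [Nat.cast_nonneg (α := ℝ) J] : a ≤ M + J)
      (by linarith [Nat.cast_nonneg (α := ℝ) J])) ?_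
    rw [← mul_zero (2 ^ |1 - s₃.re| / ‖s₁ + s₃ - 1‖ + 2 ^ |s₃.re| *
      (‖s₁‖ + ‖s₃‖ + ‖s₁‖ / ‖s₁ + s₃ - 1‖) * (2 ^ (s₁.re + s₃.re + 1) / (s₁.re + s₃.re)))]
    refine Filter.Tendsto.const_mul _ ?_
    rw [← neg_sub]
    exact (tendsto_rpow_neg_atTop (by linarith)).comp
      (Filter.tendsto_atTop_add_const_left _ _ tendsto_natCast_atTop_atTop)
  have := htail.const_sub (kernelTail s₁ s₃ a M)
  rw [sub_zero] at this
  refine this.congr fun J => ?_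
  rw [kernelTail_eq_sum_add (by linarith) hs ha haM hM J]
  ring

theorem apostolVuContinuation_eq_series {s₁ s₂ s₃ : ℂ} (h₁ : 1 < s₁.re) (h₂ : 1 < s₂.re)
    (h₃ : 1 < s₃.re) : apostolVuContinuation (s₁, s₂, s₃) = apostolVuSeries s₁ s₂ s₃ := by
  set f : ℕ → ℕ → ℂ := fun n m => if n + 1 < m then
    1 / ((m : ℂ) ^ s₁ * ((n + 1 : ℕ) : ℂ) ^ s₂ * ((m + (n + 1) : ℕ) : ℂ) ^ s₃) else 0 with hf
  have hfs : Summable (Function.uncurry f) := by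
    -- Discarding the factor (m+n)^(-s₃), of modulus at most 1, leaves a product of two convergent
    -- series, so the order of summation may be exchanged.
    have hg : Summable fun q : ℕ × ℕ => ((q.1 : ℝ) + 1) ^ (-s₂.re) * (q.2 : ℝ) ^ (-s₁.re) :=
      (summable_natCast_add_one_rpow h₂).mul_of_nonneg
        (Real.summable_nat_rpow.2 (by linarith)) (fun _ => by positivity) fun _ => by positivity
    refine .of_norm_bounded hg ?_
    rintro ⟨n, m⟩
    simp only [Function.uncurry, hf]
    split_ifs with h
    · have hm : 0 < m := by omega
      rw [norm_div, norm_one, norm_mul, norm_mul, Complex.norm_natCast_cpow_of_pos hm,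
        Complex.norm_natCast_cpow_of_pos n.succ_pos, Complex.norm_natCast_cpow_of_pos (by omega),
        Real.rpow_neg (by positivity), Real.rpow_neg (by positivity), ← mul_inv, ← one_div]
      refine one_div_le_one_div_of_le (by positivity) ?_
      rw [mul_comm ((m : ℝ) ^ s₁.re), Nat.cast_succ]
      refine le_mul_of_one_le_right (by positivity) (Real.one_le_rpow ?_ (by linarith))
      exact_mod_cast (by omega : 1 ≤ m + (n + 1))
    · rw [norm_zero]
      positivity
  have e1 : ∀ m : ℕ, ∑ n ∈ Finset.Ico 1 m,
      1 / ((m : ℂ) ^ s₁ * (n : ℂ) ^ s₂ * ((m + n : ℕ) : ℂ) ^ s₃) = ∑' n, f n m := by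
    intro m
    rw [tsum_eq_sum (s := Finset.range (m - 1)), Finset.sum_Ico_eq_sum_range]
    · refine Finset.sum_congr rfl fun n hn => ?_
      rw [Finset.mem_range] at hn
      simp only [hf]
      rw [if_pos (by omega), add_comm 1 n]
    · intro n hn
      rw [Finset.mem_range] at hn
      simp only [hf]
      rw [if_neg (by omega)]
  have e2 : ∀ n : ℕ, ∑' m, f n m = apostolVuTerm (s₁, s₂, s₃) n := by
    intro n
    have hn : (0 : ℝ) < n + 1 := by positivity
    have hfn : Summable (f n) := hfs.prod_factor n
    have hk := (hasSum_kernel (s₁ := s₁) (s₃ := s₃) (by linarith) hn.le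
      (by linarith : (n + 1 : ℝ) ≤ n + 2) (by linarith)).tsum_eq
    rw [← hfn.sum_add_tsum_nat_add (n + 2), Finset.sum_eq_zero, zero_add, apostolVuTerm]
    simp only
    rw [← hk, ← tsum_mul_left]
    · refine tsum_congr fun j => ?_
      simp only [hf, kernel]
      rw [if_pos (by omega), Complex.cpow_neg, Complex.cpow_neg, Complex.cpow_neg, one_div, mul_inv,
        mul_inv]
      push_cast
      ring_nf
    · intro m hm
      rw [Finset.mem_range] at hm
      simp only [hf]
      rw [if_neg (by omega)]
  rw [apostolVuSeries, tsum_congr e1, hfs.tsum_comm, tsum_congr e2, apostolVuContinuation]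

theorem isApostolVuContinuation_apostolVuContinuation :
    IsApostolVuContinuation apostolVuContinuation :=
  ⟨differentiableOn_apostolVuContinuation, fun _ _ _ => apostolVuContinuation_eq_series⟩

theorem apostolVuZeta_eq {s₁ s₂ s₃ : ℂ} (h : (s₁, s₂, s₃) ∈ apostolVuDomain) :
    apostolVuZeta s₁ s₂ s₃ = apostolVuContinuation (s₁, s₂, s₃) := by
  have hex : ∃ F, IsApostolVuContinuation F := ⟨_, isApostolVuContinuation_apostolVuContinuation⟩
  rw [apostolVuZeta, dif_pos hex]
  exact hex.choose_spec.eqOn isApostolVuContinuation_apostolVuContinuation h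

/-! ### Truncation of the double series -/

/-- The inner sum of `apostolVuSqTerm`. -/
noncomputable def apostolVuCoeff (s₁ s₂ : ℂ) (k : ℕ) : ℂ :=
  ∑ m ∈ (Finset.range k).filter (fun m => k < 2 * m),
    1 / ((m : ℂ) ^ s₁ * ((k - m : ℕ) : ℂ) ^ s₂)

/-- As m > k/2 and σ₁ ≥ 0, the factor m^(-σ₁) is at most (k/2)^(-σ₁). The remaining sum over n = k -
m is part of a convergent series. -/
theorem norm_apostolVuCoeff_le {s₁ s₂ : ℂ} (h₁ : 0 ≤ s₁.re) (h₂ : 1 < s₂.re) {k : ℕ}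
    (hk : 0 < k) : ‖apostolVuCoeff s₁ s₂ k‖ ≤
      2 ^ s₁.re * (∑' n : ℕ, ((n : ℝ) + 1) ^ (-s₂.re)) * (k : ℝ) ^ (-s₁.re) := by
  have hk' : (0 : ℝ) < k := by exact_mod_cast hk
  have hterm : ∀ m ∈ (Finset.range k).filter (fun m => k < 2 * m),
      ‖1 / ((m : ℂ) ^ s₁ * ((k - m : ℕ) : ℂ) ^ s₂)‖ ≤
        2 ^ s₁.re * (k : ℝ) ^ (-s₁.re) * ((k - m : ℕ) : ℝ) ^ (-s₂.re) := by
    intro m hm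
    rw [Finset.mem_filter, Finset.mem_range] at hm
    have hm0 : (k : ℝ) / 2 ≤ m := by
      have : (k : ℝ) < 2 * m := by exact_mod_cast hm.2
      linarith
    rw [norm_div, norm_one, norm_mul, Complex.norm_natCast_cpow_of_pos (by omega),
      Complex.norm_natCast_cpow_of_pos (by omega), one_div, mul_inv,
      ← Real.rpow_neg (by positivity), ← Real.rpow_neg (by positivity)]
    refine mul_le_mul_of_nonneg_right ?_ (by positivity)
    refine (Real.rpow_le_rpow_of_nonpos (by positivity) hm0 (by linarith)).trans (le_of_eq ?_)
    rw [Real.div_rpow hk'.le (by norm_num), Real.rpow_neg (by norm_num : (0 : ℝ) ≤ 2), div_inv_eq_mul,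
      mul_comm]
  have hsum : ∑ m ∈ (Finset.range k).filter (fun m => k < 2 * m),
      ((k - m : ℕ) : ℝ) ^ (-s₂.re) ≤ ∑' n : ℕ, ((n : ℝ) + 1) ^ (-s₂.re) := by
    refine (Finset.sum_le_sum_of_subset_of_nonneg (Finset.filter_subset _ _)
      fun m _ _ => by positivity).trans ?_
    rw [← Finset.sum_range_reflect]
    refine le_trans (le_of_eq ?_) ((summable_natCast_add_one_rpow h₂).sum_le_tsum
      (Finset.range k) fun n _ => by positivity)
    refine Finset.sum_congr rfl fun j hj => ?_
    rw [Finset.mem_range] at hj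
    rw [(by omega : k - (k - 1 - j) = j + 1), Nat.cast_succ]
  refine (norm_sum_le _ _).trans ((Finset.sum_le_sum hterm).trans ?_)
  rw [← Finset.mul_sum, mul_right_comm]
  gcongr

/-- Both sides sum over pairs n' < m with m + n' ≤ K. On the right n' = n + 1 and m = n + 2 + j, so
k = 2n + j + 3. -/
theorem sum_apostolVuCoeff_mul_cpow (s₁ s₂ s₃ : ℂ) (K : ℕ) :
    ∑ k ∈ Finset.range (K + 1), apostolVuCoeff s₁ s₂ k * (k : ℂ) ^ (-s₃) =
      ∑ n ∈ Finset.range K, ((n + 1 : ℝ) : ℂ) ^ (-s₂) *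
        ∑ j ∈ Finset.range (K - 2 * (n + 1)), kernel s₁ s₃ (n + 1) (n + 2 + j) := by
  simp only [apostolVuCoeff, Finset.sum_mul, Finset.mul_sum]
  rw [Finset.sum_sigma', Finset.sum_sigma']
  refine Finset.sum_bij' (fun q _ => ⟨q.1 - q.2 - 1, 2 * q.2 - q.1 - 1⟩)
    (fun q _ => ⟨2 * q.1 + q.2 + 3, q.1 + q.2 + 2⟩) ?_ ?_ ?_ ?_ ?_
  · rintro ⟨k, m⟩ h
    simp only [Finset.mem_sigma, Finset.mem_range, Finset.mem_filter] at h ⊢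
    omega
  · rintro ⟨n, j⟩ h
    simp only [Finset.mem_sigma, Finset.mem_range, Finset.mem_filter] at h ⊢
    omega
  · rintro ⟨k, m⟩ h
    simp only [Finset.mem_sigma, Finset.mem_range, Finset.mem_filter] at h
    simp only [Sigma.mk.injEq, heq_eq_eq]
    omega
  · rintro ⟨n, j⟩ h
    simp only [Sigma.mk.injEq, heq_eq_eq]
    omega
  · rintro ⟨k, m⟩ h
    simp only [Finset.mem_sigma, Finset.mem_range, Finset.mem_filter] at h
    obtain ⟨n, j, rfl, rfl⟩ : ∃ n j, k = 2 * n + j + 3 ∧ m = n + j + 2 :=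
      ⟨k - m - 1, 2 * m - k - 1, by omega, by omega⟩
    simp only [kernel]
    rw [(by omega : 2 * n + j + 3 - (n + j + 2) = n + 1), (by omega : n + 1 - 1 = n),
      (by omega : 2 * (n + j + 2) - (2 * n + j + 3) - 1 = j), one_div, mul_inv, Complex.cpow_neg,
      Complex.cpow_neg, Complex.cpow_neg, Complex.cpow_neg]
    push_cast
    ring_nf

/-- Truncation of the Apostol-Vu double series at `m + n ≤ K`. -/
theorem exists_norm_apostolVuContinuation_sub_le {s₁ s₂ : ℂ} {σ₃ : ℝ} (hσ : 0 < s₁.re + σ₃)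
    (hσ' : s₁.re + σ₃ ≤ 1) (hsum : 2 < s₁.re + s₂.re + σ₃) (ht₁ : 0 ≤ s₁.im) :
    ∃ C : ℝ, 0 ≤ C ∧ ∀ (s₃ : ℂ) (K : ℕ), s₃.re = σ₃ → 0 < s₃.im → 1 ≤ K →
      4 * (‖s₁‖ + ‖s₃‖) ≤ K →
      ‖apostolVuContinuation (s₁, s₂, s₃) -
        ∑ k ∈ Finset.range (K + 1), apostolVuCoeff s₁ s₂ k * (k : ℂ) ^ (-s₃)‖ ≤
      C * ((K : ℝ) ^ (1 - (s₁.re + σ₃)) / s₃.im) := by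
  obtain ⟨C, hC0, hC⟩ := exists_norm_kernelTail_le hσ ht₁
  set e : ℝ := s₁.re + s₂.re + σ₃ - 1 with he
  have hZ := summable_natCast_add_one_rpow (e := e) (by linarith)
  refine ⟨C * 3 ^ (1 - (s₁.re + σ₃)) * ∑' n : ℕ, ((n : ℝ) + 1) ^ (-e), by positivity, ?_⟩
  rintro s₃ K rfl ht hK hKs
  have hdom : (s₁, s₂, s₃) ∈ apostolVuDomain := by
    refine ⟨by simpa using hσ, by simpa using hsum, fun h => ?_⟩
    have := congrArg Complex.im h
    simp only [Complex.add_im, Complex.one_im] at this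
    linarith
  have hK' : (1 : ℝ) ≤ K := by exact_mod_cast hK
  set h : ℕ → ℂ := fun n => ((n + 1 : ℝ) : ℂ) ^ (-s₂) *
    ∑ j ∈ Finset.range (K - 2 * (n + 1)), kernel s₁ s₃ (n + 1) (n + 2 + j) with hh
  have h0 : ∀ n ∉ Finset.range K, h n = 0 := by
    intro n hn
    rw [Finset.mem_range] at hn
    simp only [hh]
    rw [(by omega : K - 2 * (n + 1) = 0)]
    simp
  have hr : ∀ n : ℕ, ‖apostolVuTerm (s₁, s₂, s₃) n - h n‖ ≤
      C * 3 ^ (1 - (s₁.re + s₃.re)) * ((K : ℝ) ^ (1 - (s₁.re + s₃.re)) / s₃.im) *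
        ((n : ℝ) + 1) ^ (-e) := by
    intro n
    have hn : (0 : ℝ) < n + 1 := by positivity
    have hJ := Nat.cast_nonneg (α := ℝ) (K - 2 * (n + 1))
    have e1 : apostolVuTerm (s₁, s₂, s₃) n - h n = ((n + 1 : ℝ) : ℂ) ^ (-s₂) *
        kernelTail s₁ s₃ (n + 1) (n + 2 + (K - 2 * (n + 1) : ℕ)) := by
      rw [apostolVuTerm]
      simp only
      rw [kernelTail_eq_sum_add hσ hdom.2.2 hn.le (by linarith : (n + 1 : ℝ) ≤ n + 2)
        (by linarith) (K - 2 * (n + 1))]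
      simp only [hh]
      ring
    -- The removed tail starts at M ≥ K/2 also when 2(n+1) ≥ K, where the truncated subtraction is 0
    -- and nothing has been summed. With 4(|s₁| + |s₃|) ≤ K this makes the sharp tail bound
    -- applicable for every n.
    have hM2 : (K : ℝ) ≤ 2 * (n + 2 + (K - 2 * (n + 1) : ℕ)) := by
      exact_mod_cast (by omega : K ≤ 2 * (n + 2 + (K - 2 * (n + 1))))
    -- The exponent 1 - σ is nonnegative, so this bound separates K from n. The factor (n+1)^(1-σ)
    -- is then absorbed by (n+1)^(-σ₂).
    have hM3 : (n + 2 + (K - 2 * (n + 1) : ℕ) : ℝ) ≤ 3 * K * (n + 1) := by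
      have : ((K - 2 * (n + 1) : ℕ) : ℝ) ≤ K := by exact_mod_cast Nat.sub_le _ _
      nlinarith [mul_nonneg (Nat.cast_nonneg (α := ℝ) n) (by linarith : (0 : ℝ) ≤ K - 1)]
    have hb := hC s₃ (n + 1) (n + 2 + (K - 2 * (n + 1) : ℕ)) rfl ht hn.le (by linarith)
      (by linarith) (by linarith)
    rw [e1, norm_mul, Complex.norm_cpow_eq_rpow_re_of_pos hn]
    have hpow := Real.rpow_le_rpow (by positivity) hM3 (by linarith : 0 ≤ 1 - (s₁.re + s₃.re))
    rw [Real.mul_rpow (by positivity) hn.le, Real.mul_rpow (by norm_num) (by positivity)] at hpow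
    calc _ ≤ (n + 1 : ℝ) ^ (-s₂).re * (C * ((3 ^ (1 - (s₁.re + s₃.re)) *
          (K : ℝ) ^ (1 - (s₁.re + s₃.re)) * (n + 1 : ℝ) ^ (1 - (s₁.re + s₃.re))) / s₃.im)) := by
          refine mul_le_mul_of_nonneg_left (hb.trans ?_) (by positivity)
          gcongr
      _ = _ := by
          rw [(by rw [Complex.neg_re, he]; ring : -e = (-s₂).re + (1 - (s₁.re + s₃.re))),
            Real.rpow_add hn]
          ring
  rw [sum_apostolVuCoeff_mul_cpow, apostolVuContinuation]
  change ‖∑' n, apostolVuTerm (s₁, s₂, s₃) n - ∑ n ∈ Finset.range K, h n‖ ≤ _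
  have hsh : Summable h := summable_of_ne_finset_zero h0
  have hth : ∑' n, h n = ∑ n ∈ Finset.range K, h n := tsum_eq_sum h0
  rw [← hth, ← (summable_apostolVuTerm hdom).tsum_sub hsh]
  refine (tsum_of_norm_bounded (hZ.hasSum.mul_left _) hr).trans (le_of_eq ?_)
  ring

/-! ### Mean squares of Dirichlet polynomials -/

/-- Bernoulli's inequality with exponent 1 - a ∈ (0, 1] gives (1-a)(K+1)^(-a) ≤ (K+1)^(1-a) -
K^(1-a), and this telescopes. -/
theorem sum_range_rpow_neg_le {a : ℝ} (ha : 0 ≤ a) (ha1 : a < 1) (K : ℕ) :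
    ∑ i ∈ Finset.range K, ((i : ℝ) + 1) ^ (-a) ≤ (K : ℝ) ^ (1 - a) / (1 - a) := by
  have h1a : 0 < 1 - a := by linarith
  induction K with
  | zero => simp [Real.zero_rpow h1a.ne']
  | succ K ih =>
    rw [Finset.sum_range_succ]
    have hK : (0 : ℝ) < K + 1 := by positivity
    have hb := rpow_one_add_le_one_add_mul_self (s := -(1 / ((K : ℝ) + 1))) (p := 1 - a)
      (by
        rw [neg_le_neg_iff, div_le_one hK]
        linarith [Nat.cast_nonneg (α := ℝ) K]) h1a.le (by linarith)
    have e1 : 1 + -(1 / ((K : ℝ) + 1)) = K / (K + 1) := by field_simp; ring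
    rw [e1, Real.div_rpow (by positivity) hK.le, div_le_iff₀ (by positivity)] at hb
    have e2 : ((K : ℝ) + 1) ^ (1 - a) = (K + 1) * ((K : ℝ) + 1) ^ (-a) := by
      rw [sub_eq_add_neg, Real.rpow_add hK, Real.rpow_one]
    have e3 : (1 + (1 - a) * -(1 / ((K : ℝ) + 1))) * ((K : ℝ) + 1) ^ (1 - a) =
        ((K : ℝ) + 1) ^ (1 - a) - (1 - a) * ((K : ℝ) + 1) ^ (-a) := by
      rw [e2]; field_simp; ring
    rw [e3] at hb
    push_cast
    rw [le_div_iff₀ h1a] at ih ⊢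
    nlinarith

theorem sum_one_div_abs_sub_le {K i : ℕ} (hi : i < K) :
    ∑ j ∈ (Finset.range K).erase i, 1 / |(j : ℝ) - i| ≤ 2 * (1 + Real.log K) := by
  have hH : ∀ J ≤ K, ∑ j ∈ Finset.range J, 1 / ((j : ℝ) + 1) ≤ 1 + Real.log K := by
    intro J hJ
    refine (Finset.sum_le_sum_of_subset_of_nonneg (Finset.range_subset_range.2 hJ)
      fun j _ _ => by positivity).trans (le_trans (le_of_eq ?_) (harmonic_le_one_add_log K))
    rw [harmonic]
    push_cast
    simp only [one_div]
  have hsplit : (Finset.range K).erase i = Finset.range i ∪ Finset.Ico (i + 1) K := by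
    ext j
    simp only [Finset.mem_erase, Finset.mem_range, Finset.mem_union, Finset.mem_Ico]
    omega
  have hdisj : Disjoint (Finset.range i) (Finset.Ico (i + 1) K) := by
    rw [Finset.disjoint_left]
    intro j
    simp only [Finset.mem_range, Finset.mem_Ico]
    omega
  rw [hsplit, Finset.sum_union hdisj, two_mul]
  refine add_le_add (le_trans (le_of_eq ?_) (hH i hi.le))
    (le_trans (le_of_eq ?_) (hH (K - (i + 1)) (Nat.sub_le _ _)))
  · rw [← Finset.sum_range_reflect]
    refine Finset.sum_congr rfl fun j hj => ?_
    rw [Finset.mem_range] at hj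
    have : ((i - 1 - j : ℕ) : ℝ) = i - 1 - j := by
      rw [Nat.cast_sub (by omega), Nat.cast_sub (by omega), Nat.cast_one]
    rw [this, (by ring : (i - 1 - j - i : ℝ) = -(j + 1)), abs_neg, abs_of_nonneg (by positivity)]
  · rw [Finset.sum_Ico_eq_sum_range]
    refine Finset.sum_congr rfl fun j _ => ?_
    push_cast
    rw [(by ring : ((i : ℝ) + 1 + j - i) = j + 1), abs_of_nonneg (by positivity)]

/-- For x < y, log(y/x) ≥ (y-x)/y, so 1/log(y/x) ≤ 1 + x/(y-x), and x^(-τ) y^(-τ) x ≤ x^(1-2τ). The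
y-term on the right is added only to make the bound symmetric. -/
theorem rpow_mul_rpow_div_abs_log_sub_le {τ x y : ℝ} (hτ : 0 ≤ τ) (hx : 0 < x) (hy : 0 < y)
    (hxy : x ≠ y) : x ^ (-τ) * y ^ (-τ) * (2 / |Real.log y - Real.log x|) ≤
      2 * (x ^ (-τ) * y ^ (-τ) +
        (x ^ (-(2 * τ - 1)) + y ^ (-(2 * τ - 1))) * (1 / |y - x|)) := by
  wlog h : x < y generalizing x y
  · have := this hy hx hxy.symm (lt_of_le_of_ne (not_lt.1 h) hxy.symm)
    rw [abs_sub_comm, abs_sub_comm y x]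
    linarith
  have hl : (y - x) / y ≤ Real.log y - Real.log x := by
    rw [← Real.log_div hy.ne' hx.ne']
    refine le_trans (le_of_eq ?_) (Real.one_sub_inv_le_log_of_pos (by positivity))
    field_simp
  have hyx : 0 < y - x := by linarith
  rw [abs_of_pos hyx, abs_of_pos (lt_of_lt_of_le (by positivity) hl)]
  have h1 : 2 / (Real.log y - Real.log x) ≤ 2 * (1 + x * (1 / (y - x))) := by
    calc _ ≤ 2 / ((y - x) / y) := by gcongr
      _ = _ := by field_simp; ring
  have h2 : x ^ (-τ) * y ^ (-τ) * x ≤ x ^ (-(2 * τ - 1)) := by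
    have e : x ^ (-(2 * τ - 1)) = x ^ (-τ) * x ^ (-τ) * x := by
      rw [← Real.rpow_add hx, ← Real.rpow_add_one hx.ne']
      congr 1; ring
    rw [e]
    have := Real.rpow_le_rpow_of_nonpos hx h.le (by linarith : -τ ≤ 0)
    gcongr
  have h3 : 0 ≤ y ^ (-(2 * τ - 1)) := by positivity
  calc _ ≤ x ^ (-τ) * y ^ (-τ) * (2 * (1 + x * (1 / (y - x)))) := by gcongr
    _ = 2 * (x ^ (-τ) * y ^ (-τ) + (x ^ (-τ) * y ^ (-τ) * x) * (1 / (y - x))) := by ring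
    _ ≤ _ := by
      gcongr
      linarith

/-- The first part of the pointwise bound sums to at most (∑ i^(-τ))² = O(K^(2-2τ)). The second is ∑
i^(1-2τ) times a harmonic sum over |j - i|, which causes the logarithm. -/
theorem sum_offDiag_le {τ : ℝ} (hτ : 1 / 2 ≤ τ) (hτ1 : τ < 1) (K : ℕ) :
    ∑ i ∈ Finset.range K, ∑ j ∈ (Finset.range K).erase i,
      ((i : ℝ) + 1) ^ (-τ) * ((j : ℝ) + 1) ^ (-τ) *
        (2 / |Real.log ((j : ℝ) + 1) - Real.log ((i : ℝ) + 1)|) ≤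
    (2 / (1 - τ) ^ 2 + 4 / (1 - τ)) * (K : ℝ) ^ (2 - 2 * τ) * (1 + Real.log K) := by
  rcases Nat.eq_zero_or_pos K with rfl | hKpos
  · rw [Finset.sum_range_zero, Nat.cast_zero, Real.zero_rpow (by linarith)]
    simp
  have hK : (1 : ℝ) ≤ K := by exact_mod_cast hKpos
  have hlog := Real.log_nonneg hK
  have h1τ : 0 < 1 - τ := by linarith
  set L : ℝ := 1 + Real.log K with hL
  set R : Finset ℕ := Finset.range K with hR
  have hS1 := sum_range_rpow_neg_le (a := τ) (by linarith) hτ1 K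
  have hS2 := sum_range_rpow_neg_le (a := 2 * τ - 1) (by linarith) (by linarith) K
  have hinv : ∀ i ∈ R, ∑ j ∈ R.erase i, 1 / |((j : ℝ) + 1) - (i + 1)| ≤ 2 * L := by
    intro i hi
    simp only [add_sub_add_right_eq_sub]
    exact sum_one_div_abs_sub_le (Finset.mem_range.1 hi)
  have hA : ∑ i ∈ R, ∑ j ∈ R.erase i, ((i : ℝ) + 1) ^ (-τ) * ((j : ℝ) + 1) ^ (-τ) ≤
      ((K : ℝ) ^ (1 - τ) / (1 - τ)) ^ 2 := by
    calc _ ≤ ∑ i ∈ R, ∑ j ∈ R, ((i : ℝ) + 1) ^ (-τ) * ((j : ℝ) + 1) ^ (-τ) :=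
          Finset.sum_le_sum fun i _ => Finset.sum_le_sum_of_subset_of_nonneg
            (Finset.erase_subset _ _) fun j _ _ => by positivity
      _ = (∑ i ∈ R, ((i : ℝ) + 1) ^ (-τ)) ^ 2 := by rw [sq, Finset.sum_mul_sum]
      _ ≤ _ := by
        refine pow_le_pow_left₀ (Finset.sum_nonneg fun i _ => by positivity) hS1 2
  have hB : ∑ i ∈ R, ∑ j ∈ R.erase i,
      ((i : ℝ) + 1) ^ (-(2 * τ - 1)) * (1 / |((j : ℝ) + 1) - (i + 1)|) ≤
      (K : ℝ) ^ (2 - 2 * τ) / (2 - 2 * τ) * (2 * L) := by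
    calc _ ≤ ∑ i ∈ R, ((i : ℝ) + 1) ^ (-(2 * τ - 1)) * (2 * L) := by
          refine Finset.sum_le_sum fun i hi => ?_
          rw [← Finset.mul_sum]
          exact mul_le_mul_of_nonneg_left (hinv i hi) (by positivity)
      _ = (∑ i ∈ R, ((i : ℝ) + 1) ^ (-(2 * τ - 1))) * (2 * L) := by rw [Finset.sum_mul]
      _ ≤ _ := by
        rw [(by ring : 1 - (2 * τ - 1) = 2 - 2 * τ)] at hS2
        exact mul_le_mul_of_nonneg_right hS2 (by positivity)
  have hB' : ∑ i ∈ R, ∑ j ∈ R.erase i,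
      ((j : ℝ) + 1) ^ (-(2 * τ - 1)) * (1 / |((j : ℝ) + 1) - (i + 1)|) ≤
      (K : ℝ) ^ (2 - 2 * τ) / (2 - 2 * τ) * (2 * L) := by
    refine le_trans (le_of_eq ?_) hB
    rw [Finset.sum_comm' (t' := R) (s' := fun j => R.erase j)]
    · refine Finset.sum_congr rfl fun i _ => Finset.sum_congr rfl fun j _ => ?_
      rw [abs_sub_comm]
    · intro i j
      simp only [Finset.mem_erase]
      tauto
  calc _ ≤ ∑ i ∈ R, ∑ j ∈ R.erase i, 2 * (((i : ℝ) + 1) ^ (-τ) * ((j : ℝ) + 1) ^ (-τ) +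
        (((i : ℝ) + 1) ^ (-(2 * τ - 1)) + ((j : ℝ) + 1) ^ (-(2 * τ - 1))) *
          (1 / |((j : ℝ) + 1) - (i + 1)|)) := by
        refine Finset.sum_le_sum fun i _ => Finset.sum_le_sum fun j hj => ?_
        refine rpow_mul_rpow_div_abs_log_sub_le (by linarith) (by positivity) (by positivity) ?_
        intro h
        exact (Finset.mem_erase.1 hj).1 (by exact_mod_cast (add_right_cancel h).symm)
    _ = 2 * (∑ i ∈ R, ∑ j ∈ R.erase i, ((i : ℝ) + 1) ^ (-τ) * ((j : ℝ) + 1) ^ (-τ) +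
        (∑ i ∈ R, ∑ j ∈ R.erase i,
          ((i : ℝ) + 1) ^ (-(2 * τ - 1)) * (1 / |((j : ℝ) + 1) - (i + 1)|) +
        ∑ i ∈ R, ∑ j ∈ R.erase i,
          ((j : ℝ) + 1) ^ (-(2 * τ - 1)) * (1 / |((j : ℝ) + 1) - (i + 1)|))) := by
        simp only [← Finset.sum_add_distrib, Finset.mul_sum, add_mul]
    _ ≤ 2 * (((K : ℝ) ^ (1 - τ) / (1 - τ)) ^ 2 + ((K : ℝ) ^ (2 - 2 * τ) / (2 - 2 * τ) * (2 * L) +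
        (K : ℝ) ^ (2 - 2 * τ) / (2 - 2 * τ) * (2 * L))) := by gcongr
    _ = 2 / (1 - τ) ^ 2 * (K : ℝ) ^ (2 - 2 * τ) * 1 + 4 / (1 - τ) * (K : ℝ) ^ (2 - 2 * τ) * L := by
        have e : (K : ℝ) ^ (2 - 2 * τ) = ((K : ℝ) ^ (1 - τ)) ^ 2 := by
          rw [← Real.rpow_natCast, ← Real.rpow_mul (by positivity)]
          congr 1; push_cast; ring
        rw [e, (by ring : 2 - 2 * τ = 2 * (1 - τ))]
        field_simp
        ring
    _ ≤ 2 / (1 - τ) ^ 2 * (K : ℝ) ^ (2 - 2 * τ) * L + 4 / (1 - τ) * (K : ℝ) ^ (2 - 2 * τ) * L := by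
        gcongr
        linarith
    _ = _ := by ring

theorem norm_integral_exp_mul_I_le {θ : ℝ} (hθ : θ ≠ 0) (a b : ℝ) :
    ‖∫ t in a..b, Complex.exp ((θ : ℂ) * Complex.I * t)‖ ≤ 2 / |θ| := by
  have h0 : (θ : ℂ) * Complex.I ≠ 0 := mul_ne_zero (by exact_mod_cast hθ) Complex.I_ne_zero
  have h1 : ∀ t : ℝ, ‖Complex.exp ((θ : ℂ) * Complex.I * t)‖ = 1 := fun t => by
    rw [(by push_cast; ring : (θ : ℂ) * Complex.I * t = ((θ * t : ℝ) : ℂ) * Complex.I)]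
    exact Complex.norm_exp_ofReal_mul_I _
  rw [integral_exp_mul_complex h0, norm_div, norm_mul, Complex.norm_I, mul_one, Complex.norm_real,
    Real.norm_eq_abs]
  gcongr
  exact (norm_sub_le _ _).trans (by rw [h1, h1]; norm_num)

/-- The mean square of a finite exponential sum. -/
theorem abs_integral_norm_sq_sub_le {ι : Type*} [DecidableEq ι] (R : Finset ι) (b : ι → ℂ)
    (θ : ι → ℝ) (hθ : Set.InjOn θ R) (T T' : ℝ) :
    |(∫ t in T..T', ‖∑ i ∈ R, b i * Complex.exp (-(θ i : ℂ) * Complex.I * t)‖ ^ 2) -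
        (T' - T) * ∑ i ∈ R, ‖b i‖ ^ 2| ≤
      ∑ i ∈ R, ∑ j ∈ R.erase i, ‖b i‖ * ‖b j‖ * (2 / |θ j - θ i|) := by
  have hexp : ∀ t : ℝ,
      ((‖∑ i ∈ R, b i * Complex.exp (-(θ i : ℂ) * Complex.I * t)‖ ^ 2 : ℝ) : ℂ) =
      ∑ i ∈ R, ∑ j ∈ R, b i * (starRingEnd ℂ) (b j) *
        Complex.exp (((θ j - θ i : ℝ) : ℂ) * Complex.I * t) := by
    intro t
    rw [Complex.ofReal_pow, ← Complex.mul_conj', map_sum, Finset.sum_mul_sum]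
    refine Finset.sum_congr rfl fun i _ => Finset.sum_congr rfl fun j _ => ?_
    rw [map_mul, ← Complex.exp_conj, mul_mul_mul_comm, ← Complex.exp_add]
    congr 2
    simp only [map_mul, map_neg, Complex.conj_ofReal, Complex.conj_I]
    push_cast
    ring
  have hint : (((∫ t in T..T', ‖∑ i ∈ R, b i *
      Complex.exp (-(θ i : ℂ) * Complex.I * t)‖ ^ 2 : ℝ)) : ℂ) =
      ∑ i ∈ R, ∑ j ∈ R, b i * (starRingEnd ℂ) (b j) *
        ∫ t in T..T', Complex.exp (((θ j - θ i : ℝ) : ℂ) * Complex.I * t) := by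
    rw [← intervalIntegral.integral_ofReal]
    simp only [hexp]
    have hi : ∀ i j, IntervalIntegrable (fun t : ℝ => b i * (starRingEnd ℂ) (b j) *
        Complex.exp (((θ j - θ i : ℝ) : ℂ) * Complex.I * t)) MeasureTheory.volume T T' :=
      fun i j => Continuous.intervalIntegrable (by fun_prop) _ _
    rw [intervalIntegral.integral_finsetSum fun i _ =>
      Continuous.intervalIntegrable (by fun_prop) _ _]
    refine Finset.sum_congr rfl fun i _ => ?_
    rw [intervalIntegral.integral_finsetSum fun j _ => hi i j]
    exact Finset.sum_congr rfl fun j _ => intervalIntegral.integral_const_mul _ _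
  have hdiag : ∀ i, b i * (starRingEnd ℂ) (b i) *
      ∫ t in T..T', Complex.exp (((θ i - θ i : ℝ) : ℂ) * Complex.I * t) =
      (((T' - T) * ‖b i‖ ^ 2 : ℝ) : ℂ) := by
    intro i
    simp only [sub_self, Complex.ofReal_zero, zero_mul, Complex.exp_zero,
      intervalIntegral.integral_const, Complex.mul_conj']
    rw [Complex.real_smul]
    push_cast
    ring
  rw [← Real.norm_eq_abs, ← Complex.norm_real, Complex.ofReal_sub, hint, Finset.mul_sum, Complex.ofReal_sum,
    ← Finset.sum_sub_distrib]
  refine (norm_sum_le _ _).trans (Finset.sum_le_sum fun i hi => ?_)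
  rw [← Finset.add_sum_erase _ _ hi, hdiag, add_sub_cancel_left]
  refine (norm_sum_le _ _).trans (Finset.sum_le_sum fun j hj => ?_)
  rw [norm_mul, norm_mul, RCLike.norm_conj]
  refine mul_le_mul_of_nonneg_left (norm_integral_exp_mul_I_le (sub_ne_zero.2 fun h => ?_) _ _)
    (by positivity)
  exact (Finset.mem_erase.1 hj).1 (hθ (Finset.mem_of_mem_erase hj) hi h)

/-- Pointwise, ||z|² - |S|²| ≤ E(2|S| + E), and 2|S| ≤ 1 + |S|². The cross term is thus controlled
by the mean square of S. -/
theorem abs_integral_norm_sq_sub_le_of_norm_sub_le {z S : ℝ → ℂ} {T T' E : ℝ} (hT : T ≤ T')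
    (hz : ContinuousOn z (Set.Icc T T')) (hS : Continuous S) (hE : 0 ≤ E)
    (h : ∀ t ∈ Set.Icc T T', ‖z t - S t‖ ≤ E) :
    |(∫ t in T..T', ‖z t‖ ^ 2) - ∫ t in T..T', ‖S t‖ ^ 2| ≤
      E * ((T' - T) + ∫ t in T..T', ‖S t‖ ^ 2) + E ^ 2 * (T' - T) := by
  have hzi : IntervalIntegrable (fun t => ‖z t‖ ^ 2) MeasureTheory.volume T T' :=
    ContinuousOn.intervalIntegrable_of_Icc hT (hz.norm.pow 2)
  have hSi : IntervalIntegrable (fun t => ‖S t‖ ^ 2) MeasureTheory.volume T T' :=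
    Continuous.intervalIntegrable (by fun_prop) _ _
  have hbi : IntervalIntegrable (fun t => E * (1 + ‖S t‖ ^ 2) + E ^ 2) MeasureTheory.volume T T' :=
    Continuous.intervalIntegrable (by fun_prop) _ _
  rw [← intervalIntegral.integral_sub hzi hSi, ← Real.norm_eq_abs]
  have hpt : ∀ t ∈ Set.Icc T T', ‖‖z t‖ ^ 2 - ‖S t‖ ^ 2‖ ≤ E * (1 + ‖S t‖ ^ 2) + E ^ 2 := by
    intro t ht
    have h1 := h t ht
    have h2 := abs_norm_sub_norm_le (z t) (S t)
    have h3 : ‖z t‖ ≤ ‖S t‖ + E := by linarith [le_abs_self (‖z t‖ - ‖S t‖)]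
    rw [sq_sub_sq, norm_mul, Real.norm_eq_abs, Real.norm_eq_abs,
      abs_of_nonneg (by positivity : 0 ≤ ‖z t‖ + ‖S t‖)]
    have h4 : (‖z t‖ + ‖S t‖) * |‖z t‖ - ‖S t‖| ≤ (2 * ‖S t‖ + E) * E :=
      mul_le_mul (by linarith) (h2.trans h1) (abs_nonneg _) (by positivity)
    nlinarith [mul_nonneg hE (sq_nonneg (‖S t‖ - 1))]
  refine (intervalIntegral.norm_integral_le_of_norm_le hT
    (Filter.Eventually.of_forall fun t ht => hpt t (Set.Ioc_subset_Icc_self ht)) hbi).trans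
    (le_of_eq ?_)
  have hc : ∀ c : ℝ, IntervalIntegrable (fun _ : ℝ => c) MeasureTheory.volume T T' := fun c =>
    intervalIntegrable_const
  rw [intervalIntegral.integral_add (((hc 1).add hSi).const_mul E) (hc _),
    intervalIntegral.integral_const_mul, intervalIntegral.integral_add (hc 1) hSi]
  simp only [intervalIntegral.integral_const, smul_eq_mul]
  ring

/-! ### The mean square of the Apostol-Vu double zeta-function -/

theorem apostolVuSqTerm_nonneg (s₁ s₂ : ℂ) (x : ℝ) (k : ℕ) : 0 ≤ apostolVuSqTerm s₁ s₂ x k := by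
  unfold apostolVuSqTerm
  positivity

theorem apostolVuSqTerm_eq (s₁ s₂ : ℂ) (x : ℝ) (k : ℕ) :
    apostolVuSqTerm s₁ s₂ x k = ‖apostolVuCoeff s₁ s₂ k‖ ^ 2 / (k : ℝ) ^ x := rfl

/-- The exponent τ may be smaller than σ₁ + σ₃, because the off-diagonal estimate requires τ < 1
while σ₁ + σ₃ = 1 is allowed. -/
theorem exists_norm_apostolVuCoeff_mul_le {s₁ s₂ : ℂ} {σ₃ τ : ℝ} (h₁ : 0 ≤ s₁.re)
    (h₂ : 1 < s₂.re) (hτ : τ ≤ s₁.re + σ₃) : ∃ B : ℝ, 0 ≤ B ∧ ∀ i : ℕ,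
      ‖apostolVuCoeff s₁ s₂ (i + 1)‖ * ((i : ℝ) + 1) ^ (-σ₃) ≤ B * ((i : ℝ) + 1) ^ (-τ) := by
  refine ⟨2 ^ s₁.re * ∑' n : ℕ, ((n : ℝ) + 1) ^ (-s₂.re), by positivity, fun i => ?_⟩
  have hi : (0 : ℝ) < i + 1 := by positivity
  have h := norm_apostolVuCoeff_le h₁ h₂ i.succ_pos
  rw [Nat.cast_succ] at h
  calc _ ≤ 2 ^ s₁.re * (∑' n : ℕ, ((n : ℝ) + 1) ^ (-s₂.re)) * ((i : ℝ) + 1) ^ (-s₁.re) *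
        ((i : ℝ) + 1) ^ (-σ₃) := by gcongr
    _ = 2 ^ s₁.re * (∑' n : ℕ, ((n : ℝ) + 1) ^ (-s₂.re)) *
        ((i : ℝ) + 1) ^ (-(s₁.re + σ₃)) := by
      rw [neg_add, Real.rpow_add hi]; ring
    _ ≤ _ := by
      refine mul_le_mul_of_nonneg_left ?_ (by positivity)
      exact Real.rpow_le_rpow_of_exponent_le (by linarith [Nat.cast_nonneg (α := ℝ) i])
        (by linarith)

theorem sq_norm_apostolVuCoeff_mul (s₁ s₂ : ℂ) (σ₃ : ℝ) (i : ℕ) :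
    (‖apostolVuCoeff s₁ s₂ (i + 1)‖ * ((i : ℝ) + 1) ^ (-σ₃)) ^ 2 =
      apostolVuSqTerm s₁ s₂ (2 * σ₃) (i + 1) := by
  rw [apostolVuSqTerm_eq, mul_pow, Nat.cast_succ, ← Real.rpow_natCast _ 2,
    ← Real.rpow_natCast _ 2, ← Real.rpow_mul (by positivity), div_eq_mul_inv,
    ← Real.rpow_neg (by positivity)]
  congr 2
  push_cast
  ring

theorem exists_apostolVuSqTerm_le {s₁ s₂ : ℂ} {σ₃ τ : ℝ} (h₁ : 0 ≤ s₁.re)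
    (h₂ : 1 < s₂.re) (hτ : τ ≤ s₁.re + σ₃) : ∃ B : ℝ, 0 ≤ B ∧ ∀ i : ℕ,
      apostolVuSqTerm s₁ s₂ (2 * σ₃) (i + 1) ≤ B * ((i : ℝ) + 1) ^ (-(2 * τ - 1) - 1) := by
  obtain ⟨B, hB0, hB⟩ := exists_norm_apostolVuCoeff_mul_le h₁ h₂ hτ
  refine ⟨B ^ 2, by positivity, fun i => ?_⟩
  rw [← sq_norm_apostolVuCoeff_mul]
  refine (pow_le_pow_left₀ (by positivity) (hB i) 2).trans (le_of_eq ?_)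
  rw [mul_pow, ← Real.rpow_natCast (((i : ℝ) + 1) ^ (-τ)), ← Real.rpow_mul (by positivity)]
  congr 2
  push_cast
  ring

theorem summable_apostolVuSqTerm {s₁ s₂ : ℂ} {σ₃ : ℝ} (h₁ : 0 ≤ s₁.re) (h₂ : 1 < s₂.re)
    (hσ : 1 / 2 < s₁.re + σ₃) : Summable (apostolVuSqTerm s₁ s₂ (2 * σ₃)) := by
  obtain ⟨B, -, hB⟩ := exists_apostolVuSqTerm_le h₁ h₂ (le_refl (s₁.re + σ₃))
  rw [← summable_nat_add_iff 1]
  refine .of_nonneg_of_le (fun i => apostolVuSqTerm_nonneg _ _ _ _) hB (Summable.mul_left _ ?_)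
  have := summable_natCast_add_one_rpow (e := 2 * (s₁.re + σ₃)) (by linarith)
  refine this.congr fun i => ?_
  congr 1
  ring

theorem exists_apostolVuSq_sub_sum_le {s₁ s₂ : ℂ} {σ₃ τ : ℝ} (h₁ : 0 ≤ s₁.re)
    (h₂ : 1 < s₂.re) (hτ : τ ≤ s₁.re + σ₃) (hτ2 : 1 / 2 < τ) : ∃ B : ℝ, 0 ≤ B ∧ ∀ K : ℕ,
      apostolVuSq s₁ s₂ (2 * σ₃) -
        ∑ k ∈ Finset.range (K + 1), apostolVuSqTerm s₁ s₂ (2 * σ₃) k ≤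
      B * ((K : ℝ) + 1) ^ (-(2 * τ - 1)) := by
  obtain ⟨B, hB0, hB⟩ := exists_apostolVuSqTerm_le h₁ h₂ hτ
  have hτ0 : 0 < 2 * τ - 1 := by linarith
  have hsum := summable_apostolVuSqTerm h₁ h₂ (hτ2.trans_le hτ)
  refine ⟨B * (2 ^ (2 * τ - 1 + 1) / (2 * τ - 1)), by positivity, fun K => ?_⟩
  have hK : (1 : ℝ) ≤ K + 1 := by linarith [Nat.cast_nonneg (α := ℝ) K]
  rw [apostolVuSq, ← hsum.sum_add_tsum_nat_add (K + 1), add_sub_cancel_left]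
  calc _ ≤ ∑' j : ℕ, B * ((K : ℝ) + 1 + j) ^ (-(2 * τ - 1) - 1) := by
        refine Summable.tsum_le_tsum (fun j => ?_) ((summable_nat_add_iff (K + 1)).2 hsum)
          ((summable_rpow_neg_succ hτ0 hK).mul_left B)
        have := hB (j + K)
        rw [add_assoc] at this
        refine this.trans (le_of_eq ?_)
        push_cast
        ring_nf
    _ = B * ∑' j : ℕ, ((K : ℝ) + 1 + j) ^ (-(2 * τ - 1) - 1) := tsum_mul_left
    _ ≤ B * (2 ^ (2 * τ - 1 + 1) / (2 * τ - 1) * ((K : ℝ) + 1) ^ (-(2 * τ - 1))) :=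
        mul_le_mul_of_nonneg_left (tsum_rpow_neg_succ_le hτ0 hK) hB0
    _ = _ := by ring

/-- The Dirichlet polynomial approximating the Apostol-Vu double zeta-function. -/
noncomputable def apostolVuPartial (s₁ s₂ : ℂ) (σ₃ : ℝ) (K : ℕ) (t : ℝ) : ℂ :=
  ∑ k ∈ Finset.range (K + 1),
    apostolVuCoeff s₁ s₂ k * (k : ℂ) ^ (-((σ₃ : ℂ) + (t : ℂ) * Complex.I))

theorem apostolVuPartial_eq (s₁ s₂ : ℂ) (σ₃ : ℝ) (K : ℕ) (t : ℝ) :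
    apostolVuPartial s₁ s₂ σ₃ K t = ∑ i ∈ Finset.range K,
      apostolVuCoeff s₁ s₂ (i + 1) * ((i + 1 : ℝ) : ℂ) ^ (-(σ₃ : ℂ)) *
        Complex.exp (-(Real.log ((i : ℝ) + 1) : ℂ) * Complex.I * t) := by
  rw [apostolVuPartial, Finset.sum_range_succ']
  have h0 : apostolVuCoeff s₁ s₂ 0 = 0 := by simp [apostolVuCoeff]
  rw [h0, zero_mul, add_zero]
  refine Finset.sum_congr rfl fun i _ => ?_
  have hi : (0 : ℝ) < i + 1 := by positivity
  have hi' : ((i + 1 : ℝ) : ℂ) ≠ 0 := by exact_mod_cast hi.ne'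
  rw [(by push_cast; ring : ((i + 1 : ℕ) : ℂ) = ((i + 1 : ℝ) : ℂ)), neg_add,
    Complex.cpow_add _ _ hi', ← mul_assoc, Complex.cpow_def_of_ne_zero hi' (-((t : ℂ) * _)),
    ← Complex.ofReal_log hi.le]
  congr 2
  ring

theorem continuous_apostolVuPartial (s₁ s₂ : ℂ) (σ₃ : ℝ) (K : ℕ) :
    Continuous (apostolVuPartial s₁ s₂ σ₃ K) := by
  rw [funext (apostolVuPartial_eq s₁ s₂ σ₃ K)]
  fun_prop

theorem exists_apostolVuPartial_meanSquare {s₁ s₂ : ℂ} {σ₃ τ : ℝ} (h₁ : 0 ≤ s₁.re)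
    (h₂ : 1 < s₂.re) (hτ : τ ≤ s₁.re + σ₃) (hτ2 : 1 / 2 ≤ τ) (hτ1 : τ < 1) :
    ∃ C : ℝ, 0 ≤ C ∧ ∀ (K : ℕ) (T T' : ℝ),
      |(∫ t in T..T', ‖apostolVuPartial s₁ s₂ σ₃ K t‖ ^ 2) -
        (T' - T) * ∑ k ∈ Finset.range (K + 1), apostolVuSqTerm s₁ s₂ (2 * σ₃) k| ≤
      C * (K : ℝ) ^ (2 - 2 * τ) * (1 + Real.log K) := by
  obtain ⟨B, hB0, hB⟩ := exists_norm_apostolVuCoeff_mul_le h₁ h₂ hτ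
  have h1τ : 0 < 1 - τ := by linarith
  refine ⟨B ^ 2 * (2 / (1 - τ) ^ 2 + 4 / (1 - τ)), by positivity, fun K T T' => ?_⟩
  have hb : ∀ i : ℕ, ‖apostolVuCoeff s₁ s₂ (i + 1) * ((i + 1 : ℝ) : ℂ) ^ (-(σ₃ : ℂ))‖ =
      ‖apostolVuCoeff s₁ s₂ (i + 1)‖ * ((i : ℝ) + 1) ^ (-σ₃) := by
    intro i
    rw [norm_mul, Complex.norm_cpow_eq_rpow_re_of_pos (by positivity), Complex.neg_re,
      Complex.ofReal_re]
  have hinj : Set.InjOn (fun i : ℕ => Real.log ((i : ℝ) + 1)) (Finset.range K) := by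
    intro i _ j _ h
    have h' := Real.log_injOn_pos (Set.mem_Ioi.2 (by positivity : (0 : ℝ) < i + 1))
      (Set.mem_Ioi.2 (by positivity : (0 : ℝ) < j + 1)) h
    exact_mod_cast add_right_cancel h'
  have h := abs_integral_norm_sq_sub_le (Finset.range K)
    (fun i => apostolVuCoeff s₁ s₂ (i + 1) * ((i + 1 : ℝ) : ℂ) ^ (-(σ₃ : ℂ)))
    (fun i => Real.log ((i : ℝ) + 1)) hinj T T'
  simp only [← apostolVuPartial_eq, hb, sq_norm_apostolVuCoeff_mul] at h
  have h0 : apostolVuSqTerm s₁ s₂ (2 * σ₃) 0 = 0 := by simp [apostolVuSqTerm]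
  rw [Finset.sum_range_succ', h0, add_zero]
  refine h.trans ?_
  calc _ ≤ ∑ i ∈ Finset.range K, ∑ j ∈ (Finset.range K).erase i,
        B ^ 2 * (((i : ℝ) + 1) ^ (-τ) * ((j : ℝ) + 1) ^ (-τ) *
          (2 / |Real.log ((j : ℝ) + 1) - Real.log ((i : ℝ) + 1)|)) := by
        refine Finset.sum_le_sum fun i _ => Finset.sum_le_sum fun j _ => ?_
        refine (mul_le_mul_of_nonneg_right (mul_le_mul (hB i) (hB j) (by positivity)
          (by positivity)) (by positivity)).trans (le_of_eq (by ring))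
    _ ≤ B ^ 2 * ((2 / (1 - τ) ^ 2 + 4 / (1 - τ)) * (K : ℝ) ^ (2 - 2 * τ) *
        (1 + Real.log K)) := by
      simp only [← Finset.mul_sum]
      exact mul_le_mul_of_nonneg_left (sum_offDiag_le hτ2 hτ1 K) (by positivity)
    _ = _ := by ring

theorem mem_apostolVuDomain {s₁ s₂ : ℂ} {σ₃ t : ℝ} (hσ : 0 < s₁.re + σ₃)
    (hsum : 2 < s₁.re + s₂.re + σ₃) (ht₁ : 0 ≤ s₁.im) (ht : 0 < t) :
    (s₁, s₂, (σ₃ : ℂ) + (t : ℂ) * Complex.I) ∈ apostolVuDomain := by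
  refine ⟨by simpa using hσ, by simpa using hsum, fun h => ?_⟩
  have := congrArg Complex.im h
  simp at this
  linarith

theorem continuousOn_apostolVuZeta {s₁ s₂ : ℂ} {σ₃ : ℝ} (hσ : 0 < s₁.re + σ₃)
    (hsum : 2 < s₁.re + s₂.re + σ₃) (ht₁ : 0 ≤ s₁.im) :
    ContinuousOn (fun t : ℝ => apostolVuZeta s₁ s₂ ((σ₃ : ℂ) + (t : ℂ) * Complex.I))
      (Set.Ioi 0) := by
  have hc : ContinuousOn (fun t : ℝ =>
      apostolVuContinuation (s₁, s₂, (σ₃ : ℂ) + (t : ℂ) * Complex.I)) (Set.Ioi 0) :=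
    differentiableOn_apostolVuContinuation.continuousOn.comp (by fun_prop)
      fun t ht => mem_apostolVuDomain hσ hsum ht₁ ht
  exact hc.congr fun t ht => apostolVuZeta_eq (mem_apostolVuDomain hσ hsum ht₁ ht)

/-- The mean square over a dyadic block. -/
theorem exists_meanSquare_block {s₁ s₂ : ℂ} {σ₃ τ : ℝ} (h₁ : 0 ≤ s₁.re) (hσ₃ : 0 < σ₃)
    (hσ' : s₁.re + σ₃ ≤ 1) (hsum : 2 < s₁.re + s₂.re + σ₃) (ht₁ : 0 ≤ s₁.im)
    (hτ : τ ≤ s₁.re + σ₃) (hτ2 : 1 / 2 < τ) (hτ1 : τ < 1) :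
    ∃ C : ℝ, 0 ≤ C ∧ ∀ T T' : ℝ, 2 ≤ T → T ≤ T' → T' ≤ 2 * T →
      |(∫ t in T..T', ‖apostolVuZeta s₁ s₂ ((σ₃ : ℂ) + (t : ℂ) * Complex.I)‖ ^ 2) -
        apostolVuSq s₁ s₂ (2 * σ₃) * (T' - T)| ≤ C * (T ^ (2 - 2 * τ) * Real.log T) := by
  have h₂ : 1 < s₂.re := by linarith
  have hσ : 0 < s₁.re + σ₃ := by linarith
  obtain ⟨C₁, hC₁0, hC₁⟩ := exists_norm_apostolVuContinuation_sub_le hσ hσ' hsum ht₁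
  obtain ⟨C₂, hC₂0, hC₂⟩ := exists_apostolVuPartial_meanSquare h₁ h₂ hτ hτ2.le hτ1
  obtain ⟨B, hB0, hB⟩ := exists_apostolVuSq_sub_sum_le h₁ h₂ hτ hτ2
  have hsumm := summable_apostolVuSqTerm h₁ h₂ (hτ2.trans_le hτ)
  set A : ℝ := apostolVuSq s₁ s₂ (2 * σ₃) with hA
  have hA0 : 0 ≤ A := tsum_nonneg fun k => apostolVuSqTerm_nonneg _ _ _ _
  -- For t ≤ 2T and T ≥ 1 one has 4(|s₁| + |σ₃ + it|) ≤ 4(|s₁| + σ₃ + 2T) ≤ cT. Hence a single K =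
  -- ⌈cT⌉ serves the whole block.
  set c : ℝ := 4 * (‖s₁‖ + σ₃ + 2) with hc
  have hc8 : 8 ≤ c := by linarith [norm_nonneg s₁]
  set D₁ : ℝ := C₁ * (c + 1) ^ (1 - (s₁.re + σ₃)) with hD₁
  set D₂ : ℝ := C₂ * (c + 1) ^ (2 - 2 * τ) * (2 * (1 + Real.log (c + 1)) + 1) with hD₂
  have hlogc : 0 ≤ Real.log (c + 1) := Real.log_nonneg (by linarith)
  have hD₁0 : 0 ≤ D₁ := by positivity
  have hD₂0 : 0 ≤ D₂ := by positivity
  refine ⟨D₁ * (2 * (1 + A) + D₂) + 2 * D₁ ^ 2 + D₂ + 2 * B, by positivity, ?_⟩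
  intro T T' hT hTT' hT'
  have hT0 : 0 < T := by linarith
  have hT1 : 1 ≤ T := by linarith
  have hlogT : 1 ≤ 2 * Real.log T := by
    have := Real.log_le_log (by norm_num) hT
    linarith [Real.log_two_gt_d9]
  set X : ℝ := T ^ (2 - 2 * τ) * Real.log T with hX
  have hTX : T ^ (2 - 2 * τ) ≤ 2 * X := by
    have := mul_le_mul_of_nonneg_left hlogT (by positivity : 0 ≤ T ^ (2 - 2 * τ))
    rw [hX]
    linarith
  have hX0 : 0 ≤ X := by
    have : 0 ≤ T ^ (2 - 2 * τ) := by positivity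
    linarith
  set K : ℕ := ⌈c * T⌉₊ with hKd
  have hK1 : c * T ≤ K := Nat.le_ceil _
  have hK2 : (K : ℝ) ≤ (c + 1) * T := by
    have := Nat.ceil_lt_add_one (by positivity : 0 ≤ c * T)
    rw [hKd]
    linarith
  have hTK : T ≤ K := by nlinarith
  have hKpos : (1 : ℝ) ≤ K := by linarith
  have hKnat : 1 ≤ K := by exact_mod_cast hKpos
  have hsecond : |(∫ t in T..T', ‖apostolVuPartial s₁ s₂ σ₃ K t‖ ^ 2) -
      (T' - T) * ∑ k ∈ Finset.range (K + 1), apostolVuSqTerm s₁ s₂ (2 * σ₃) k| ≤ D₂ * X := by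
    refine (hC₂ K T T').trans ?_
    have e1 : (K : ℝ) ^ (2 - 2 * τ) ≤ (c + 1) ^ (2 - 2 * τ) * T ^ (2 - 2 * τ) := by
      rw [← Real.mul_rpow (by linarith) hT0.le]
      exact Real.rpow_le_rpow (by positivity) hK2 (by linarith)
    have e2 : 1 + Real.log K ≤ (2 * (1 + Real.log (c + 1)) + 1) * Real.log T := by
      have := Real.log_le_log (by linarith) hK2
      rw [Real.log_mul (by linarith) hT0.ne'] at this
      nlinarith
    calc _ ≤ C₂ * ((c + 1) ^ (2 - 2 * τ) * T ^ (2 - 2 * τ)) *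
          ((2 * (1 + Real.log (c + 1)) + 1) * Real.log T) := by
          have := Real.log_nonneg hKpos
          gcongr
      _ = _ := by rw [hD₂, hX]; ring
  have hle : ∑ k ∈ Finset.range (K + 1), apostolVuSqTerm s₁ s₂ (2 * σ₃) k ≤ A :=
    hsumm.sum_le_tsum _ fun k _ => apostolVuSqTerm_nonneg _ _ _ _
  have hthird : (T' - T) *
      (A - ∑ k ∈ Finset.range (K + 1), apostolVuSqTerm s₁ s₂ (2 * σ₃) k) ≤ 2 * B * X := by
    calc _ ≤ T * (B * T ^ (-(2 * τ - 1))) := by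
          refine mul_le_mul (by linarith) ((hB K).trans ?_) (by linarith) hT0.le
          refine mul_le_mul_of_nonneg_left ?_ hB0
          exact Real.rpow_le_rpow_of_nonpos hT0 (by linarith) (by linarith)
      _ = B * T ^ (2 - 2 * τ) := by
          rw [(by ring : 2 - 2 * τ = -(2 * τ - 1) + 1), Real.rpow_add_one hT0.ne']; ring
      _ ≤ B * (2 * X) := by gcongr
      _ = _ := by ring
  -- The truncation error K^(1-σ)/t is O(T^(-σ)) because K ≍ t ≍ T. This is why the range of
  -- integration is cut into dyadic blocks.
  set E : ℝ := D₁ * T ^ (-τ) with hEd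
  have hE0 : 0 ≤ E := by positivity
  have hE1 : E ≤ D₁ := mul_le_of_le_one_right hD₁0
    (Real.rpow_le_one_of_one_le_of_nonpos hT1 (by linarith))
  have hET : E * T ≤ 2 * D₁ * X := by
    have : T ^ (-τ) * T ≤ T ^ (2 - 2 * τ) := by
      rw [← Real.rpow_add_one hT0.ne']
      exact Real.rpow_le_rpow_of_exponent_le hT1 (by linarith)
    calc E * T = D₁ * (T ^ (-τ) * T) := by rw [hEd]; ring
      _ ≤ D₁ * (2 * X) := mul_le_mul_of_nonneg_left (this.trans hTX) hD₁0
      _ = _ := by ring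
  have hEbound : ∀ t ∈ Set.Icc T T',
      ‖apostolVuZeta s₁ s₂ ((σ₃ : ℂ) + (t : ℂ) * Complex.I) - apostolVuPartial s₁ s₂ σ₃ K t‖ ≤
        E := by
    intro t ht
    have ht0 : 0 < t := hT0.trans_le ht.1
    rw [apostolVuZeta_eq (mem_apostolVuDomain hσ hsum ht₁ ht0), apostolVuPartial]
    have him : ((σ₃ : ℂ) + (t : ℂ) * Complex.I).im = t := by simp
    have hre : ((σ₃ : ℂ) + (t : ℂ) * Complex.I).re = σ₃ := by simp
    have hn : ‖(σ₃ : ℂ) + (t : ℂ) * Complex.I‖ ≤ σ₃ + t := by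
      refine (norm_add_le _ _).trans (le_of_eq ?_)
      rw [norm_mul, Complex.norm_I, mul_one, Complex.norm_real, Complex.norm_real,
        Real.norm_of_nonneg hσ₃.le, Real.norm_of_nonneg ht0.le]
    have hs : 4 * (‖s₁‖ + ‖(σ₃ : ℂ) + (t : ℂ) * Complex.I‖) ≤ K := by
      have := ht.2
      nlinarith [mul_nonneg (by positivity : 0 ≤ ‖s₁‖ + σ₃) (by linarith : 0 ≤ T - 1)]
    have h := hC₁ _ K hre (by rw [him]; exact ht0) hKnat hs
    rw [him] at h
    refine h.trans ?_
    have e1 : (K : ℝ) ^ (1 - (s₁.re + σ₃)) ≤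
        (c + 1) ^ (1 - (s₁.re + σ₃)) * T ^ (1 - (s₁.re + σ₃)) := by
      rw [← Real.mul_rpow (by linarith) hT0.le]
      exact Real.rpow_le_rpow (by positivity) hK2 (by linarith)
    have e2 : T ^ (1 - (s₁.re + σ₃)) ≤ T ^ (-τ) * T := by
      rw [← Real.rpow_add_one hT0.ne']
      exact Real.rpow_le_rpow_of_exponent_le hT1 (by linarith)
    calc _ ≤ C₁ * ((c + 1) ^ (1 - (s₁.re + σ₃)) * (T ^ (-τ) * T) / T) := by
          have := ht.1
          gcongr
          exact e1.trans (by gcongr)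
      _ = E := by rw [hEd, hD₁]; field_simp
  have hfirst := abs_integral_norm_sq_sub_le_of_norm_sub_le hTT'
    ((continuousOn_apostolVuZeta hσ hsum ht₁).mono fun t ht => hT0.trans_le ht.1)
    (continuous_apostolVuPartial s₁ s₂ σ₃ K) hE0 hEbound
  set IZ : ℝ := ∫ t in T..T', ‖apostolVuZeta s₁ s₂ ((σ₃ : ℂ) + (t : ℂ) * Complex.I)‖ ^ 2
  set IS : ℝ := ∫ t in T..T', ‖apostolVuPartial s₁ s₂ σ₃ K t‖ ^ 2
  set P : ℝ := ∑ k ∈ Finset.range (K + 1), apostolVuSqTerm s₁ s₂ (2 * σ₃) k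
  have hIS : IS ≤ T * A + D₂ * X := by
    have e1 := (abs_le.1 hsecond).2
    have e2 : (T' - T) * P ≤ (T' - T) * A := mul_le_mul_of_nonneg_left hle (by linarith)
    have e3 : (T' - T) * A ≤ T * A := mul_le_mul_of_nonneg_right (by linarith) hA0
    linarith
  have hfirst' : E * ((T' - T) + IS) + E ^ 2 * (T' - T) ≤
      (D₁ * (2 * (1 + A) + D₂) + 2 * D₁ ^ 2) * X := by
    calc _ ≤ E * (T + (T * A + D₂ * X)) + E ^ 2 * T := by
          gcongr <;> linarith
      _ = (E * T) * (1 + A) + E * (D₂ * X) + E * (E * T) := by ring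
      _ ≤ (2 * D₁ * X) * (1 + A) + D₁ * (D₂ * X) + D₁ * (2 * D₁ * X) := by gcongr
      _ = _ := by ring
  have htotal : IZ - A * (T' - T) = (IZ - IS) + (IS - (T' - T) * P) - (T' - T) * (A - P) := by ring
  have hnn : 0 ≤ (T' - T) * (A - P) := mul_nonneg (by linarith) (by linarith)
  rw [htotal]
  refine ((abs_sub _ _).trans (add_le_add_left (abs_add_le _ _) _)).trans ?_
  rw [abs_of_nonneg hnn]
  linarith

/-- Summation over dyadic blocks. -/
theorem exists_abs_integral_sub_le_of_dyadic {g : ℝ → ℝ} (hg : ContinuousOn g (Set.Ioi 0))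
    {A β C : ℝ} (hβ : 0 < β) (hC : 0 ≤ C)
    (h : ∀ T T' : ℝ, 2 ≤ T → T ≤ T' → T' ≤ 2 * T →
      |(∫ t in T..T', g t) - A * (T' - T)| ≤ C * (T ^ β * Real.log T)) :
    ∃ C' : ℝ, 0 ≤ C' ∧ ∀ T : ℝ, 2 ≤ T →
      |(∫ t in (2 : ℝ)..T, g t) - A * (T - 2)| ≤ C' * (T ^ β * Real.log T) := by
  set q : ℝ := 2 ^ β with hq
  have hq1 : 1 < q := Real.one_lt_rpow (by norm_num) hβ
  have hq0 : 0 < q - 1 := by linarith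
  -- Halving T divides T^β by q, so the induction needs (C' + C)/q ≤ C', that is, C ≤ C'(q-1). The
  -- extra factor q in the numerator ensures C ≤ C' for the base case.
  set C' : ℝ := C * q / (q - 1) with hC'
  have hC'0 : 0 ≤ C' := by positivity
  have hCC' : C ≤ C' := by
    rw [hC', le_div_iff₀ hq0]
    nlinarith
  have hmain : ∀ n : ℕ, ∀ T : ℝ, 2 ≤ T → T ≤ 4 * 2 ^ n →
      |(∫ t in (2 : ℝ)..T, g t) - A * (T - 2)| ≤ C' * (T ^ β * Real.log T) := by
    have hbase : ∀ T : ℝ, 2 ≤ T → T ≤ 4 →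
        |(∫ t in (2 : ℝ)..T, g t) - A * (T - 2)| ≤ C' * (T ^ β * Real.log T) := by
      intro T hT hT4
      refine (h 2 T le_rfl hT (by linarith)).trans ?_
      have := Real.log_nonneg (by norm_num : (1 : ℝ) ≤ 2)
      gcongr
    intro n
    induction n with
    | zero => intro T hT hT4; exact hbase T hT (by simpa using hT4)
    | succ n ih =>
      intro T hT hTn
      rcases le_total T 4 with hT4 | hT4
      · exact hbase T hT hT4
      have hi : ∀ a b : ℝ, 2 ≤ a → a ≤ b → IntervalIntegrable g MeasureTheory.volume a b :=
        fun a b ha hab => ContinuousOn.intervalIntegrable_of_Icc hab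
          (hg.mono fun t ht => lt_of_lt_of_le (by linarith : (0 : ℝ) < a) ht.1)
      have h1 := ih (T / 2) (by linarith) (by rw [pow_succ] at hTn; linarith)
      have h2 := h (T / 2) T (by linarith) (by linarith) (by linarith)
      have hadd := intervalIntegral.integral_add_adjacent_intervals
        (hi 2 (T / 2) le_rfl (by linarith)) (hi (T / 2) T (by linarith) (by linarith))
      have hT0 : 0 < T := by linarith
      have hpow : (T / 2) ^ β = T ^ β / q := Real.div_rpow hT0.le (by norm_num) β
      have hlog : Real.log (T / 2) ≤ Real.log T := Real.log_le_log (by linarith) (by linarith)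
      have hX : (T / 2) ^ β * Real.log (T / 2) ≤ T ^ β * Real.log T / q := by
        rw [hpow, div_mul_eq_mul_div]
        gcongr
      rw [← hadd]
      have e : (∫ t in (2 : ℝ)..(T / 2), g t) + (∫ t in (T / 2)..T, g t) - A * (T - 2) =
          ((∫ t in (2 : ℝ)..(T / 2), g t) - A * (T / 2 - 2)) +
          ((∫ t in (T / 2)..T, g t) - A * (T - T / 2)) := by ring
      rw [e]
      calc _ ≤ C' * ((T / 2) ^ β * Real.log (T / 2)) + C * ((T / 2) ^ β * Real.log (T / 2)) :=
            (abs_add_le _ _).trans (add_le_add h1 h2)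
        _ ≤ C' * (T ^ β * Real.log T / q) + C * (T ^ β * Real.log T / q) := by gcongr
        _ = (C' + C) / q * (T ^ β * Real.log T) := by ring
        _ ≤ _ := by
          have hlogT : 0 ≤ Real.log T := Real.log_nonneg (by linarith)
          refine mul_le_mul_of_nonneg_right ?_ (by positivity)
          rw [div_le_iff₀ (by linarith)]
          have : C' * (q - 1) = C * q := by rw [hC']; field_simp
          nlinarith
  refine ⟨C', hC'0, fun T hT => ?_⟩
  obtain ⟨n, hn⟩ := pow_unbounded_of_one_lt T (by norm_num : (1 : ℝ) < 2)
  exact hmain n T hT (by linarith)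

theorem theorem1p2 (s₁ s₂ : ℂ) (σ₃ : ℝ)
    (hσ₁ : 0 ≤ s₁.re) (hσ₃ : 0 < σ₃)
    (hlow : 1 / 2 < s₁.re + σ₃) (hupp : s₁.re + σ₃ ≤ 1)
    (hsum : 2 < s₁.re + s₂.re + σ₃) (ht₁ : 0 ≤ s₁.im) :
    Summable (apostolVuSqTerm s₁ s₂ (2 * σ₃)) ∧
    ∃ C : ℝ, 0 < C ∧ ∀ T : ℝ, 2 ≤ T →
      (∀ t ∈ Set.Icc 2 T, s₁ + ((σ₃ : ℂ) + (t : ℂ) * Complex.I) ≠ 1) →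
      IntervalIntegrable
        (fun t : ℝ => ‖apostolVuZeta s₁ s₂ ((σ₃ : ℂ) + (t : ℂ) * Complex.I)‖ ^ 2)
        MeasureTheory.volume 2 T ∧
      (s₁.re + σ₃ ≤ 3 / 4 →
        |(∫ t in (2 : ℝ)..T, ‖apostolVuZeta s₁ s₂ ((σ₃ : ℂ) + (t : ℂ) * Complex.I)‖ ^ 2)
            - apostolVuSq s₁ s₂ (2 * σ₃) * T|
          ≤ C * (T ^ (2 - 2 * s₁.re - 2 * σ₃) * Real.log T)) ∧
      (3 / 4 < s₁.re + σ₃ →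
        |(∫ t in (2 : ℝ)..T, ‖apostolVuZeta s₁ s₂ ((σ₃ : ℂ) + (t : ℂ) * Complex.I)‖ ^ 2)
            - apostolVuSq s₁ s₂ (2 * σ₃) * T|
          ≤ C * T ^ (1 / 2 : ℝ)) := by
  refine ⟨summable_apostolVuSqTerm hσ₁ (by linarith) hlow, ?_⟩
  -- Any cap strictly between 3/4 and 1 works: it is inactive when σ₁ + σ₃ ≤ 3/4, and otherwise
  -- gives 2 - 2τ < 1/2 while keeping τ < 1.
  set τ : ℝ := min (s₁.re + σ₃) (4 / 5) with hτ
  have hτσ : τ ≤ s₁.re + σ₃ := min_le_left _ _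
  have hτ2 : 1 / 2 < τ := lt_min hlow (by norm_num)
  have hτ1 : τ ≤ 4 / 5 := min_le_right _ _
  set β : ℝ := 2 - 2 * τ with hβ
  have hg : ContinuousOn
      (fun t : ℝ => ‖apostolVuZeta s₁ s₂ ((σ₃ : ℂ) + (t : ℂ) * Complex.I)‖ ^ 2) (Set.Ioi 0) :=
    (continuousOn_apostolVuZeta (by linarith) hsum ht₁).norm.pow 2
  obtain ⟨C₀, hC₀, hblock⟩ := exists_meanSquare_block hσ₁ hσ₃ hupp hsum ht₁ hτσ hτ2 (by linarith)
  obtain ⟨C, hC, hint⟩ := exists_abs_integral_sub_le_of_dyadic hg (by linarith : 0 < β) hC₀ hblock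
  set A : ℝ := apostolVuSq s₁ s₂ (2 * σ₃) with hA
  have hA0 : 0 ≤ A := tsum_nonneg fun k => apostolVuSqTerm_nonneg _ _ _ _
  -- Passing from T - 2 to T in the main term costs 2A, which is at most 4A·T^β log T because 2T^β
  -- log T ≥ 1.
  set D : ℝ := C + 4 * A with hD
  have hD0 : 0 ≤ D := by positivity
  -- One constant must serve both cases. The absolute value keeps this summand nonnegative when β >
  -- 1/2, and at β = 1/2 division by zero makes it 0. For β < 1/2 it is the cost of bounding log T
  -- by T^(1/2-β)/(1/2-β).
  have hδ0 : 0 ≤ D / |1 / 2 - β| := by positivity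
  refine ⟨D + D / |1 / 2 - β| + 1, by positivity, fun T hT _ => ⟨?_, ?_⟩⟩
  · exact ContinuousOn.intervalIntegrable_of_Icc hT
      (hg.mono fun t ht => lt_of_lt_of_le (by norm_num : (0 : ℝ) < 2) ht.1)
  have hT0 : 0 < T := by linarith
  have hlogT : 1 ≤ 2 * Real.log T := by
    have := Real.log_le_log (by norm_num) hT
    linarith [Real.log_two_gt_d9]
  have hX1 : 1 ≤ 2 * (T ^ β * Real.log T) := by
    have h1 : 1 ≤ T ^ β := Real.one_le_rpow (by linarith) (by linarith)
    nlinarith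
  have hmain : |(∫ t in (2 : ℝ)..T,
      ‖apostolVuZeta s₁ s₂ ((σ₃ : ℂ) + (t : ℂ) * Complex.I)‖ ^ 2) - A * T| ≤
      D * (T ^ β * Real.log T) := by
    have h := abs_le.1 (hint T hT)
    rw [abs_le, hD]
    constructor <;> nlinarith
  constructor
  · intro h34
    have hτe : τ = s₁.re + σ₃ := min_eq_left (by linarith)
    rw [(by rw [hβ, hτe]; ring : 2 - 2 * s₁.re - 2 * σ₃ = β)]
    refine hmain.trans (mul_le_mul_of_nonneg_right (by linarith) (by linarith))
  · intro h34
    have hτ34 : 3 / 4 < τ := lt_min h34 (by norm_num)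
    have hδ : 0 < 1 / 2 - β := by linarith
    rw [abs_of_pos hδ] at hδ0 ⊢
    have hlog := Real.log_le_rpow_div hT0.le hδ
    calc _ ≤ D * (T ^ β * Real.log T) := hmain
      _ ≤ D * (T ^ β * (T ^ (1 / 2 - β) / (1 / 2 - β))) := by gcongr
      _ = D / (1 / 2 - β) * T ^ (1 / 2 : ℝ) := by
        rw [mul_div_assoc', ← Real.rpow_add hT0, add_sub_cancel]
        ring
      _ ≤ _ := mul_le_mul_of_nonneg_right (by linarith) (by positivity)
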